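/- **General stability of the Runge--Kutta spectral volume (RKSV) scheme.** Consider $u_t+\beta u_x=g$ on $[a,b]$, $\beta>0$, with periodic boundary conditions. *Mesh.* Let $[a,b]$ be partitioned into finitely many cells $I_i=[x_{i-1/2},x_{i+1/2}]$ of lengths $h_i$, $h=\max_i h_i$, and let each cell be divided into $k+1$ control volumes $I_{i,j}=[x_{i,j},x_{i,j+1}]$, $0\le j\le k$, by points $x_{i-1/2}=x_{i,0}<x_{i,1}<\dots<x_{i,k+1}=x_{i+1/2}$. Assume that the mesh is quasi-uniform, $h\le\rho h_i$ for all $i$, and that the subdivision of each cell is the affine image of one of finitely many fixed reference patterns, collected in a finite set $P$. Let $\mathbb V^k$ be the space of functions that are polynomials of degree $\le k$ on each cell. *Scheme.* Consider an explicit $s$-stage Runge--Kutta method of order $r\ge1$, with coefficients $c_{\ell\kappa},d_{\ell\kappa}$ ($0\le\kappa\le\ell<s$) and $\sum_{\kappa\le\ell}c_{\ell\kappa}=1$. The RKSV solution $u^{n}\in\mathbb V^k$ with time step $\tau>0$ has stages $u^{n,\ell}\in\mathbb V^k$ with $u^{n,0}=u^n$, $u^{n+1}=u^{n,s}$ and,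 for every control volume $I_{i,j}$ and $0\le\ell<s$, $$\int_{I_{i,j}}u^{n,\ell+1}dx=\sum_{\kappa\le\ell}\Big(c_{\ell\kappa}\int_{I_{i,j}}u^{n,\kappa}dx+\tau d_{\ell\kappa}\Big[\beta\big(\hat u^{n,\kappa}_{i,j}-\hat u^{n,\kappa}_{i,j+1}\big)+\int_{I_{i,j}}g^{n,\kappa}dx\Big]\Big),$$ where $\hat u_{i,j}=u(x_{i,j})$ for $1\le j\le k$, the value of $\hat u$ at a cell interface is the trace from the left (upwind) cell, periodically, and $g^{n,\kappa}\in L^2(a,b)$ are the source terms at the stages. *Quadrature and energy norm.* For weights $A_{i,j}$ put $Q_i(v)=\sum_{j=0}^{k+1}A_{i,j}v(x_{i,j})$. Assume that there are weights such that, for every $i$: $Q_i(v)=\int_{I_i}v\,dx$ for all polynomials $v$ of degree $\le 2k-1$; $\frac{h_i}{2k-1}-Q_i(L_{i,k+1}L_{i,k-1})>0$, where $L_{i,\ell}$ is the Legendre polynomial of degree $\ell$ shifted to $I_i$ with $\int_{I_i}L_{i,\ell}^2=\frac{h_i}{2\ell+1}$ (both conditions are void if $k=0$); and the *upwind condition*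 $A_{i,0}=0$ holds. For $\omega\in\mathbb V^k$ let $M^*\omega$ be constant on each control volume, with $M^*\omega|_{I_{i,0}}=\omega(x_{i-1/2}^+)+A_{i,0}\,\omega_x(x_{i-1/2}^+)$ and $M^*\omega|_{I_{i,j}}-M^*\omega|_{I_{i,j-1}}=A_{i,j}\,\omega_x(x_{i,j})$ for $1\le j\le k$. The energy norm is $\|v\|_*=\sqrt{\int_a^b v\,M^*v\,dx}$, and $\|\cdot\|$ denotes the $L^2(a,b)$ norm. **Theorem.** There is $\gamma\ge1$, depending only on the Runge--Kutta method, and there are $C_{\rm CFL}>0$, $C\ge0$, $\hat C\ge0$, depending only on the Runge--Kutta method, $a,b,\beta,k,\rho$ and the set $P$ of reference patterns (and not on the mesh, $h$, $\tau$, $n$, the source terms or the solution), such that, whenever all the above assumptions hold and $\tau/h^{\gamma}\le C_{\rm CFL}$, every RKSV solution satisfies, for every $n$, $$\|u^{n+1}\|_*^2\le(1+C\tau)\|u^n\|_*^2+\hat C\,\tau\sum_{0\le\ell<s}\|g^{n,\ell}\|^2 .$$ -/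

import Mathlib

open scoped Polynomial Topology ContDiff

noncomputable section

namespace RKSV

/-! ## Explicit Runge-Kutta methods in Shu-Osher form -/

/-- An explicit `s`-stage Runge-Kutta method for `y' = f(y)`, in the form
`Y₀ = yₙ`, `Y_{ℓ+1} = ∑_{κ ≤ ℓ} (c_{ℓκ} Y_κ + τ d_{ℓκ} f(Y_κ))` for `0 ≤ ℓ < s`, `y_{n+1} = Y_s`,
with `∑_{κ ≤ ℓ} c_{ℓκ} = 1`. Coefficients other than those with `κ ≤ ℓ < s` are never used. -/
structure RKMethod where
  s : ℕ
  c : ℕ → ℕ → ℝ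
  d : ℕ → ℕ → ℝ
  sum_c : ∀ ℓ < s, ∑ κ ∈ Finset.range (ℓ + 1), c ℓ κ = 1

/-- The stages of the method for the autonomous system `y' = f(y)` with step `τ`, started at `y`. -/
def RKMethod.stage {E : Type*} [AddCommGroup E] [Module ℝ E]
    (rk : RKMethod) (f : E → E) (τ : ℝ) (y : E) : ℕ → E
  | 0 => y
  | ℓ + 1 => ∑ κ : Fin (ℓ + 1),
      (rk.c ℓ κ • rk.stage f τ y κ + (τ * rk.d ℓ κ) • f (rk.stage f τ y κ))
termination_by ℓ => ℓ
decreasing_by all_goals exact κ.isLt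

/-- The method is of order (at least) `r`: for every smooth autonomous system, in any dimension,
the local error of one step started on an exact solution is `O(τ^{r+1})`. -/
def RKMethod.HasOrder (rk : RKMethod) (r : ℕ) : Prop :=
  ∀ (m : ℕ) (f : (Fin m → ℝ) → (Fin m → ℝ)), ContDiff ℝ ∞ f →
    ∀ y : ℝ → (Fin m → ℝ), (∀ᶠ t in 𝓝 0, HasDerivAt y (f (y t)) t) →
      (fun τ : ℝ => y τ - rk.stage f τ (y 0) rk.s) =O[𝓝[>] 0] (fun τ : ℝ => τ ^ (r + 1))

/-! ## Meshes, subdivisions and the discontinuous finite element space -/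

/-- A partition of `[a, b]` into `N` cells `I_i = [e_i, e_{i+1}]`, each with a subdivision
`x_{i,0} < x_{i,1} < ⋯ < x_{i,k+1}` into `k + 1` control volumes `[x_{i,j}, x_{i,j+1}]`,
where `x_{i,0}` and `x_{i,k+1}` are the left and right ends of the cell. -/
structure SVMesh (a b : ℝ) (k N : ℕ) where
  e : Fin (N + 1) → ℝ
  e_first : e 0 = a
  e_last : e (Fin.last N) = b
  x : Fin N → Fin (k + 2) → ℝ
  x_strictMono : ∀ i, StrictMono (x i)
  x_first : ∀ i, x i 0 = e i.castSucc
  x_last : ∀ i, x i (Fin.last (k + 1)) = e i.succ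

/-- The space `𝕍ᵏ` of piecewise polynomials of degree at most `k`: one polynomial for each cell. -/
abbrev DGSpace (k N : ℕ) : Type := Fin N → Polynomial.degreeLT ℝ (k + 1)

namespace SVMesh

variable {a b : ℝ} {k N : ℕ}

/-- The length `h_i` of the cell `I_i`. -/
def cellSize (M : SVMesh a b k N) (i : Fin N) : ℝ := M.e i.succ - M.e i.castSucc

/-- The mesh size `h = max_i h_i`. -/
def meshSize [NeZero N] (M : SVMesh a b k N) : ℝ :=
  Finset.univ.sup' Finset.univ_nonempty M.cellSize

/-- Quasi-uniformity with constant `ρ`. -/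
def QuasiUniform [NeZero N] (M : SVMesh a b k N) (ρ : ℝ) : Prop :=
  ∀ i, M.meshSize ≤ ρ * M.cellSize i

/-- In each cell the subdivision is the affine image of one of the reference patterns in `P`,
given on the unit interval. -/
def SubdividedBy (M : SVMesh a b k N) (P : Finset (Fin (k + 2) → ℝ)) : Prop :=
  ∀ i, ∃ ξ ∈ P, ∀ j, M.x i j = M.e i.castSucc + M.cellSize i * ξ j

/-! ## Quadrature on the subdivision points -/

/-- `Q_i(p) = ∑_j A_{i,j} p(x_{i,j})`. -/
def quad (M : SVMesh a b k N) (A : Fin N → Fin (k + 2) → ℝ) (i : Fin N) (p : ℝ[X]) : ℝ :=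
  ∑ j, A i j * p.eval (M.x i j)

/-- The Legendre polynomial `L_{i,ℓ}` of degree `ℓ` shifted to the cell `I_i`, with value `1` at the
right end of the cell. (Mathlib's `shiftedLegendre ℓ` lives on `[0, 1]` and has value `(-1)^ℓ`
at `1`.) -/
def legendre (M : SVMesh a b k N) (i : Fin N) (ℓ : ℕ) : ℝ[X] :=
  (-1) ^ ℓ * ((Polynomial.shiftedLegendre ℓ).map (Int.castRingHom ℝ)).comp
    (Polynomial.C (M.cellSize i)⁻¹ * (Polynomial.X - Polynomial.C (M.e i.castSucc)))

/-- The assumption on the quadrature: exactness on polynomials of degree at most `2k - 1` (no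
condition if `k = 0`) and the positivity condition `h_i / (2k-1) - Q_i(L_{i,k+1} L_{i,k-1}) > 0`
(which is meaningful for `k ≥ 1` only). -/
structure Admissible (M : SVMesh a b k N) (A : Fin N → Fin (k + 2) → ℝ) : Prop where
  exact_quad : ∀ i, ∀ p : ℝ[X], p.degree < ((2 * k : ℕ) : WithBot ℕ) →
    ∫ t in M.e i.castSucc..M.e i.succ, p.eval t = M.quad A i p
  pos : 1 ≤ k → ∀ i,
    0 < M.cellSize i / (2 * k - 1) - M.quad A i (M.legendre i (k + 1) * M.legendre i (k - 1))

/-- The weights at the left ends of all cells vanish. -/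
def Upwind (A : Fin N → Fin (k + 2) → ℝ) : Prop := ∀ i, A i 0 = 0

/-! ## The from-trial-to-test-space mapping and the energy norm -/

/-- The value of `M*w` on the control volume `[x_{i,j}, x_{i,j+1}]`; see `mStar_zero` and
`mStar_succ` for its recursive form. -/
def mStar (M : SVMesh a b k N) (A : Fin N → Fin (k + 2) → ℝ) (w : DGSpace k N)
    (i : Fin N) (j : Fin (k + 1)) : ℝ :=
  (w i : ℝ[X]).eval (M.x i 0) +
    ∑ l ∈ Finset.Iic j.castSucc, A i l * (w i : ℝ[X]).derivative.eval (M.x i l)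

theorem mStar_zero (M : SVMesh a b k N) (A : Fin N → Fin (k + 2) → ℝ) (w : DGSpace k N)
    (i : Fin N) :
    M.mStar A w i 0 =
      (w i : ℝ[X]).eval (M.x i 0) + A i 0 * (w i : ℝ[X]).derivative.eval (M.x i 0) := by
  have h : Finset.Iic (Fin.castSucc (0 : Fin (k + 1))) = {0} := by
    ext l; simp
  simp only [mStar, h, Finset.sum_singleton]

theorem mStar_succ (M : SVMesh a b k N) (A : Fin N → Fin (k + 2) → ℝ) (w : DGSpace k N)
    (i : Fin N) (j : Fin k) :
    M.mStar A w i j.succ - M.mStar A w i j.castSucc =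
      A i j.succ.castSucc *
        (w i : ℝ[X]).derivative.eval (M.x i j.succ.castSucc) := by
  have h : Finset.Iic (j.succ.castSucc) =
      insert j.succ.castSucc (Finset.Iic (j.castSucc.castSucc)) := by
    ext l
    simp only [Finset.mem_Iic, Finset.mem_insert, Fin.le_def, Fin.ext_iff, Fin.val_castSucc,
      Fin.val_succ]
    omega
  have h' : j.succ.castSucc ∉ Finset.Iic (j.castSucc.castSucc) := by
    simp [Fin.le_def]
  simp only [mStar, h, Finset.sum_insert h']
  ring

/-- The integral of `v` over the control volume `[x_{i,j}, x_{i,j+1}]`. -/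
def cvIntegral (M : SVMesh a b k N) (v : DGSpace k N) (i : Fin N) (j : Fin (k + 1)) : ℝ :=
  ∫ t in M.x i j.castSucc..M.x i j.succ, (v i : ℝ[X]).eval t

/-- The bilinear form `(v, w)_* = (v, M*w)`, where `(·, ·)` is the `L²` inner product and `M*w` is
constant on each control volume. -/
def starInner (M : SVMesh a b k N) (A : Fin N → Fin (k + 2) → ℝ) (v w : DGSpace k N) : ℝ :=
  ∑ i, ∑ j, M.cvIntegral v i j * M.mStar A w i j

/-- The energy norm `‖v‖_* = √(v, v)_*`. -/
def starNorm (M : SVMesh a b k N) (A : Fin N → Fin (k + 2) → ℝ) (v : DGSpace k N) : ℝ :=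
  Real.sqrt (M.starInner A v v)

/-! ## The fully discrete spectral volume scheme -/

/-- The upwind value of `v` at `x_{i,j}`, for a positive velocity and periodic boundary conditions:
at the left end of a cell it is the trace from the (cyclically) preceding cell. -/
def upwindValue [NeZero N] (M : SVMesh a b k N) (v : DGSpace k N) (i : Fin N)
    (j : Fin (k + 2)) : ℝ :=
  if j = 0 then (v (i - 1) : ℝ[X]).eval (M.x (i - 1) (Fin.last (k + 1)))
  else (v i : ℝ[X]).eval (M.x i j)

/-- `u` (time levels `uⁿ` for `0 ≤ n ≤ steps`) and `U` (stages `u^{n,ℓ}`) form a solution of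
the Runge-Kutta spectral volume scheme for `u_t + β u_x = g` on `[a, b]` with periodic boundary
conditions, upwind fluxes, time step `τ`, and stage values `g^{n,ℓ}` of the source: the balance law
holds in each control volume. -/
structure IsSolution [NeZero N] (M : SVMesh a b k N) (rk : RKMethod) (β τ : ℝ) (steps : ℕ)
    (g : ℕ → ℕ → ℝ → ℝ) (u : ℕ → DGSpace k N) (U : ℕ → ℕ → DGSpace k N) : Prop where
  first_stage : ∀ n < steps, U n 0 = u n
  stages : ∀ n < steps, ∀ ℓ < rk.s, ∀ i j,
    M.cvIntegral (U n (ℓ + 1)) i j =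
      ∑ κ ∈ Finset.range (ℓ + 1),
        (rk.c ℓ κ * M.cvIntegral (U n κ) i j +
          τ * rk.d ℓ κ *
            (β * (M.upwindValue (U n κ) i j.castSucc - M.upwindValue (U n κ) i j.succ) +
              ∫ t in M.x i j.castSucc..M.x i j.succ, g n κ t))
  last_stage : ∀ n < steps, u (n + 1) = U n rk.s

end SVMesh

end RKSV

end

/-! Write the scheme as `U' = L U + G` on the finite-dimensional space of piecewise polynomials,
where `L` is `svOperator`. Every Runge–Kutta method of order at least one satisfies the claim with
`γ = 2`, because in the energy inner product `L` is dissipative and `‖L‖` is `O(1/h)`.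

If `τ ≤ h²`, then `‖τL‖² ≤ Kτ`. Order at least one gives `Uˢ = U⁰ + τLU⁰ + R`, and the remainder is
bounded by a multiple of `‖τL‖²‖U⁰‖ + τ∑‖G‖`, hence of `τ(‖U⁰‖ + ∑‖G‖)`. In `‖U⁰ + τLU⁰‖²` the cross
term is nonpositive and the square is at most `Kτ‖U⁰‖²`, so one step multiplies the energy by `1 +
O(τ)`, up to sources (`RKMethod.exists_norm_sq_step_le`).

On one cell, summation by parts shows that the energy form is the `L²` product plus a rank-one term:
the product of the leading coefficients times the quadrature defect of `X^(2k)` (`cellInner_eq`). It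
is therefore symmetric. Splitting off the component along the Legendre polynomial of degree `k`
turns the positivity assumption on the quadrature into positive definiteness
(`RefAdmissible.cellInner_pos`). The vanishing left weight makes the flux terms collapse to
interface values, which sum to a nonpositive quantity by periodicity (`starForm_svOperator_nonpos`).

The inverse estimate (`starForm_svOperator_le`) comes from norm equivalence on a reference cell and
scaling. Its constants depend only on `P`: there are finitely many patterns, and the nodes of a
pattern determine its energy form. -/

namespace RKSV

open Polynomial

/-! ### Consistency and energy growth of Runge–Kutta methods -/

/-- The stages of the method for `y' = 1` with unit step, started at `0`. -/
noncomputable def RKMethod.slope (rk : RKMethod) (l : ℕ) : ℝ :=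
  rk.stage (fun _ : ℝ => 1) 1 0 l

theorem RKMethod.slope_zero (rk : RKMethod) : rk.slope 0 = 0 := by
  simp [slope, stage]

theorem RKMethod.slope_succ (rk : RKMethod) (l : ℕ) :
    rk.slope (l + 1) = ∑ κ ∈ Finset.range (l + 1), (rk.c l κ * rk.slope κ + rk.d l κ) := by
  rw [slope, stage, Finset.sum_range]
  simp [slope]

theorem RKMethod.stage_const {E : Type*} [AddCommGroup E] [Module ℝ E] (rk : RKMethod) (v : E)
    (τ : ℝ) (l : ℕ) : rk.stage (fun _ => v) τ 0 l = (τ * rk.slope l) • v := by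
  induction l using Nat.strong_induction_on with
  | _ l ih =>
    cases l with
    | zero => simp [stage, slope_zero]
    | succ l =>
      rw [stage, slope_succ, Finset.sum_range, Finset.mul_sum, Finset.sum_smul]
      refine Finset.sum_congr rfl fun κ _ => ?_
      rw [ih κ κ.isLt, smul_smul, ← add_smul]
      congr 1
      ring

/-- A method of positive order is consistent. -/
theorem RKMethod.HasOrder.slope_eq_one {rk : RKMethod} {r : ℕ} (h : rk.HasOrder r) (hr : 1 ≤ r) :
    rk.slope rk.s = 1 := by
  -- For `y' = 1` the error of one step is exactly `τ (1 - slope)`. Dividing by `τ` makes the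
  -- constant `1 - slope` an `O(τ^r)`, which tends to zero.
  have h1 := h 1 (fun _ _ => 1) contDiff_const (fun t _ => t)
    (Filter.Eventually.of_forall fun t => hasDerivAt_pi.2 fun _ => hasDerivAt_id t)
  have h2 : (fun τ : ℝ => τ * (1 - rk.slope rk.s)) =O[𝓝[>] 0] (fun τ : ℝ => τ * τ ^ r) := by
    have := (Asymptotics.isBigO_pi.1 h1) 0
    refine (this.congr (fun τ => ?_) fun τ => ?_)
    · have h0 : (fun _ : Fin 1 => (0 : ℝ)) = 0 := rfl
      simp only [Pi.sub_apply, h0, stage_const, Pi.smul_apply, smul_eq_mul]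
      ring
    · ring
  have h3 : (fun _ : ℝ => 1 - rk.slope rk.s) =O[𝓝[>] 0] (fun τ : ℝ => τ ^ r) := by
    refine Asymptotics.IsBigO.congr' (((Asymptotics.isBigO_refl (fun τ : ℝ => τ⁻¹) _).mul h2))
      ?_ ?_ <;>
    · filter_upwards [self_mem_nhdsWithin] with τ hτ
      have : τ ≠ 0 := ne_of_gt hτ
      field_simp
  have h4 : Filter.Tendsto (fun τ : ℝ => τ ^ r) (𝓝[>] 0) (𝓝 0) := by
    have := (continuous_pow (M := ℝ) r).tendsto 0
    rw [zero_pow (by omega)] at this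
    exact this.mono_left nhdsWithin_le_nhds
  have h5 := tendsto_nhds_unique (h3.trans_tendsto h4) tendsto_const_nhds
  linarith

/-- A discrete Gronwall inequality, with a constant independent of the sequence. -/
theorem exists_discrete_gronwall (p q : ℕ → ℕ → ℝ) (hp : ∀ l κ, 0 ≤ p l κ) (n : ℕ) :
    ∃ C, 0 ≤ C ∧ ∀ (ρ : ℕ → ℝ) (Z : ℝ), 0 ≤ Z → ρ 0 ≤ 0 →
      (∀ l < n, ρ (l + 1) ≤ ∑ κ ∈ Finset.range (l + 1), (p l κ * ρ κ + q l κ * Z)) →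
      ∀ l ≤ n, ρ l ≤ C * Z := by
  induction n with
  | zero =>
    refine ⟨0, le_rfl, fun ρ Z _ h0 _ l hl => ?_⟩
    obtain rfl : l = 0 := by omega
    simpa using h0
  | succ n ih =>
    obtain ⟨C, hC, h⟩ := ih
    -- The second entry of the maximum is the right side of the recursion at the last index, with
    -- every earlier term replaced by its bound `C * Z`.
    refine ⟨max C (∑ κ ∈ Finset.range (n + 1), (p n κ * C + q n κ)), le_max_of_le_left hC,
      fun ρ Z hZ h0 hρ l hl => ?_⟩
    have ih' := h ρ Z hZ h0 fun l hl => hρ l (by omega)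
    rcases Nat.lt_or_ge n l with hnl | hln
    · obtain rfl : l = n + 1 := by omega
      refine (hρ n (by omega)).trans (le_trans ?_ (mul_le_mul_of_nonneg_right (le_max_right _ _) hZ))
      rw [Finset.sum_mul]
      refine Finset.sum_le_sum fun κ hκ => ?_
      have := mul_le_mul_of_nonneg_left (ih' κ (by simp at hκ; omega)) (hp n κ)
      linarith
    · exact (ih' l hln).trans (mul_le_mul_of_nonneg_right (le_max_left _ _) hZ)

/-- The first-order expansion of the stages of a Runge-Kutta method for a linear equation. -/
theorem RKMethod.exists_norm_stage_sub_le (rk : RKMethod) (α₀ : ℝ) :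
    ∃ C, 0 ≤ C ∧ ∀ (E : Type) [NormedAddCommGroup E] [InnerProductSpace ℝ E] (L : E →ₗ[ℝ] E)
      (τ α : ℝ) (U G : ℕ → E), 0 < τ → 0 ≤ α → α ≤ α₀ → (∀ v, ‖τ • L v‖ ≤ α * ‖v‖) →
      (∀ l < rk.s, U (l + 1) = ∑ κ ∈ Finset.range (l + 1),
        (rk.c l κ • U κ + (τ * rk.d l κ) • (L (U κ) + G κ))) →
      ‖U rk.s - U 0 - (τ * rk.slope rk.s) • L (U 0)‖ ≤
        C * (α ^ 2 * ‖U 0‖ + τ * ∑ κ ∈ Finset.range rk.s, ‖G κ‖) := by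
  obtain ⟨C, hC, h⟩ := exists_discrete_gronwall
    (fun l κ => |rk.c l κ| + |rk.d l κ| * |α₀|) (fun l κ => |rk.d l κ| * (|rk.slope κ| + 1))
    (fun l κ => by positivity) rk.s
  refine ⟨C, hC, fun E _ _ L τ α U G hτ hα hα₀ hL hU => ?_⟩
  refine h (fun l => ‖U l - U 0 - (τ * rk.slope l) • L (U 0)‖) _ (by positivity)
    (by simp [slope_zero]) (fun l hl => ?_) rk.s le_rfl
  set R : ℕ → E := fun l => U l - U 0 - (τ * rk.slope l) • L (U 0) with hR
  -- The zeroth-order parts cancel because the `c` sum to one, and the first-order parts by the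
  -- recursion for `slope`. What is left involves `(τL)²U⁰`, the earlier remainders and the sources.
  have key : R (l + 1) = ∑ κ ∈ Finset.range (l + 1), (rk.c l κ • R κ +
      rk.d l κ • (rk.slope κ • (τ • L (τ • L (U 0))) + τ • L (R κ) + τ • G κ)) := by
    have e1 : U 0 = ∑ κ ∈ Finset.range (l + 1), rk.c l κ • U 0 := by
      rw [← Finset.sum_smul, rk.sum_c l hl, one_smul]
    have e2 : (τ * rk.slope (l + 1)) • L (U 0) = ∑ κ ∈ Finset.range (l + 1),
        (τ * (rk.c l κ * rk.slope κ + rk.d l κ)) • L (U 0) := by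
      rw [slope_succ, Finset.mul_sum, Finset.sum_smul]
    change U (l + 1) - U 0 - _ = _
    rw [e2, hU l hl]
    conv_lhs => enter [1, 2]; rw [e1]
    rw [← Finset.sum_sub_distrib, ← Finset.sum_sub_distrib]
    refine Finset.sum_congr rfl fun κ _ => ?_
    simp only [hR, map_sub, map_smul]
    module
  change ‖R (l + 1)‖ ≤ _
  rw [key]
  refine (norm_sum_le _ _).trans (Finset.sum_le_sum fun κ hκ => ?_)
  have hκ : κ < rk.s := by simp at hκ; omega
  have hG : ‖G κ‖ ≤ ∑ κ ∈ Finset.range rk.s, ‖G κ‖ :=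
    Finset.single_le_sum (f := fun κ => ‖G κ‖) (fun _ _ => norm_nonneg _) (by simpa using hκ)
  have b1 : ‖τ • L (τ • L (U 0))‖ ≤ α ^ 2 * ‖U 0‖ := by
    refine (hL _).trans ?_
    rw [pow_two, mul_assoc]
    exact mul_le_mul_of_nonneg_left (hL _) hα
  have b2 : ‖τ • L (R κ)‖ ≤ |α₀| * ‖R κ‖ := (hL _).trans
    (mul_le_mul_of_nonneg_right (hα₀.trans (le_abs_self _)) (norm_nonneg _))
  have b3 : ‖τ • G κ‖ ≤ τ * ∑ κ ∈ Finset.range rk.s, ‖G κ‖ := by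
    rw [norm_smul, Real.norm_of_nonneg hτ.le]
    exact mul_le_mul_of_nonneg_left hG hτ.le
  have hS : 0 ≤ τ * ∑ κ ∈ Finset.range rk.s, ‖G κ‖ := by positivity
  calc _ ≤ |rk.c l κ| * ‖R κ‖ + |rk.d l κ| *
        (|rk.slope κ| * ‖τ • L (τ • L (U 0))‖ + ‖τ • L (R κ)‖ + ‖τ • G κ‖) := by
        refine (norm_add_le _ _).trans ?_
        rw [norm_smul, norm_smul, Real.norm_eq_abs, Real.norm_eq_abs]
        gcongr
        refine (norm_add₃_le).trans ?_
        rw [norm_smul (rk.slope κ), Real.norm_eq_abs]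
    _ ≤ |rk.c l κ| * ‖R κ‖ + |rk.d l κ| *
        (|rk.slope κ| * (α ^ 2 * ‖U 0‖) + |α₀| * ‖R κ‖ +
          τ * ∑ κ ∈ Finset.range rk.s, ‖G κ‖) := by gcongr
    _ ≤ |rk.c l κ| * ‖R κ‖ + |rk.d l κ| *
        (|rk.slope κ| * (α ^ 2 * ‖U 0‖ + τ * ∑ κ ∈ Finset.range rk.s, ‖G κ‖) + |α₀| * ‖R κ‖ +
          (α ^ 2 * ‖U 0‖ + τ * ∑ κ ∈ Finset.range rk.s, ‖G κ‖)) := by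
        gcongr
        · linarith
        · have : 0 ≤ α ^ 2 * ‖U 0‖ := by positivity
          linarith
    _ = _ := by ring

/-- Energy growth of one step of a consistent Runge-Kutta method for a dissipative linear equation,
under the step size restriction `‖τ L‖² ≤ K τ`. -/
theorem RKMethod.exists_norm_sq_step_le (rk : RKMethod) (hrk : rk.slope rk.s = 1) (K T : ℝ)
    (hK : 0 ≤ K) :
    ∃ C, 0 ≤ C ∧ ∃ C', 0 ≤ C' ∧
      ∀ (E : Type) [NormedAddCommGroup E] [InnerProductSpace ℝ E] (L : E →ₗ[ℝ] E)
      (τ : ℝ) (U G : ℕ → E), 0 < τ → τ ≤ T → (∀ v, inner ℝ (L v) v ≤ 0) →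
      (∀ v, ‖τ • L v‖ ^ 2 ≤ K * τ * ‖v‖ ^ 2) →
      (∀ l < rk.s, U (l + 1) = ∑ κ ∈ Finset.range (l + 1),
        (rk.c l κ • U κ + (τ * rk.d l κ) • (L (U κ) + G κ))) →
      ‖U rk.s‖ ^ 2 ≤ (1 + C * τ) * ‖U 0‖ ^ 2 +
        C' * τ * ∑ κ ∈ Finset.range rk.s, ‖G κ‖ ^ 2 := by
  obtain ⟨B, hB, h⟩ := rk.exists_norm_stage_sub_le (√(K * T))
  set D := B * (K + 1) with hD
  have hD0 : 0 ≤ D := by positivity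
  -- `K` comes from the forward Euler part, the terms with `D ^ 2` from the square of the remainder,
  -- and those linear in `D` from its product with the Euler part. The factor `rk.s` is from
  -- Cauchy–Schwarz over the stages.
  refine ⟨K + |T| * D ^ 2 * 2 + (1 + √(K * T)) * D * 3, by positivity,
    (|T| * D ^ 2 * 2 + (1 + √(K * T)) * D) * rk.s, by positivity,
    fun E _ _ L τ U G hτ hT hdiss hL hU => ?_⟩
  have hKτ : 0 ≤ K * τ := by positivity
  have hL' : ∀ v, ‖τ • L v‖ ≤ √(K * τ) * ‖v‖ := fun v => by
    refine abs_le_of_sq_le_sq' ?_ (by positivity) |>.2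
    rw [mul_pow, Real.sq_sqrt hKτ]
    exact hL v
  have hα : √(K * τ) ≤ √(K * T) := Real.sqrt_le_sqrt (by gcongr)
  have hR := h E L τ (√(K * τ)) U G hτ (Real.sqrt_nonneg _) hα hL' hU
  rw [hrk, mul_one, Real.sq_sqrt hKτ] at hR
  set S := ∑ κ ∈ Finset.range rk.s, ‖G κ‖ with hS
  have hS0 : 0 ≤ S := by positivity
  set R := U rk.s - U 0 - τ • L (U 0) with hRdef
  have hUs : U rk.s = (U 0 + τ • L (U 0)) + R := by rw [hRdef]; abel
  set x := ‖U 0‖ with hx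
  have hx0 : 0 ≤ x := norm_nonneg _
  -- With `α = √(Kτ)`, the quadratic term `α²` is already of size `τ`, so the whole remainder
  -- carries a factor `τ`.
  have hR' : ‖R‖ ≤ D * τ * (x + S) := by
    refine hR.trans ?_
    have : 0 ≤ B * τ * (x + K * S) := by positivity
    rw [hD]; nlinarith
  have hS2 : S ^ 2 ≤ rk.s * ∑ κ ∈ Finset.range rk.s, ‖G κ‖ ^ 2 := by
    have := sq_sum_le_card_mul_sum_sq (s := Finset.range rk.s) (f := fun κ => ‖G κ‖)
    simpa using this
  -- Dissipativity removes the first-order cross term. A bound by norms alone would leave a loss of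
  -- size `√τ`.
  have hmain : ‖U 0 + τ • L (U 0)‖ ^ 2 ≤ x ^ 2 + K * τ * x ^ 2 := by
    rw [norm_add_sq_real, inner_smul_right, real_inner_comm]
    have := hL (U 0)
    have := mul_nonneg hτ.le (neg_nonneg.2 (hdiss (U 0)))
    linarith
  have hmain' : ‖U 0 + τ • L (U 0)‖ ≤ (1 + √(K * T)) * x := by
    refine (norm_add_le _ _).trans ?_
    have := (hL' (U 0)).trans (mul_le_mul_of_nonneg_right hα hx0)
    linarith
  have hcross : inner ℝ (U 0 + τ • L (U 0)) R ≤ (1 + √(K * T)) * x * (D * τ * (x + S)) :=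
    (real_inner_le_norm _ _).trans (mul_le_mul hmain' hR' (norm_nonneg _) (by positivity))
  have hRsq : ‖R‖ ^ 2 ≤ D ^ 2 * |T| * τ * (2 * x ^ 2 + 2 * S ^ 2) := by
    calc ‖R‖ ^ 2 ≤ (D * τ * (x + S)) ^ 2 := by gcongr
      _ = D ^ 2 * τ * τ * (x + S) ^ 2 := by ring
      _ ≤ D ^ 2 * |T| * τ * (2 * x ^ 2 + 2 * S ^ 2) := by
        gcongr
        · exact hT.trans (le_abs_self _)
        · nlinarith [sq_nonneg (x - S)]
  have hcross2 : x * (x + S) * 2 ≤ 3 * x ^ 2 + S ^ 2 := by nlinarith [sq_nonneg (x - S)]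
  have hcross3 := mul_le_mul_of_nonneg_left hcross2
    (show 0 ≤ (1 + √(K * T)) * D * τ by positivity)
  have hfin := mul_le_mul_of_nonneg_left hS2
    (show 0 ≤ (|T| * D ^ 2 * 2 + (1 + √(K * T)) * D) * τ by positivity)
  rw [hUs, norm_add_sq_real]
  linarith

/-! ### Summation by parts and polynomial calculus -/

theorem sum_succ_sub_castSucc {n : ℕ} (W : Fin (n + 1) → ℝ) :
    ∑ j : Fin n, (W j.succ - W j.castSucc) = W (Fin.last n) - W 0 := by
  rw [Finset.sum_sub_distrib]
  have h1 := Fin.sum_univ_succ W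
  have h2 := Fin.sum_univ_castSucc W
  linarith

/-- Summation by parts. -/
theorem sum_mul_partial_sum {k : ℕ} (V f : Fin (k + 2) → ℝ) (w : ℝ) :
    ∑ j : Fin (k + 1), (V j.succ - V j.castSucc) * (w + ∑ l ∈ Finset.Iic j.castSucc, f l) =
      V (Fin.last _) * (w + ∑ l, f l) - V 0 * w - ∑ l, V l * f l := by
  have h (l : Fin (k + 2)) : (∑ j : Fin (k + 1),
      if l ≤ j.castSucc then V j.succ - V j.castSucc else 0) = V (Fin.last _) - V l := by
    -- Truncating with `max j l` kills the increments before `l`, so the conditional sum telescopes.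
    have := sum_succ_sub_castSucc (fun j => V (max j l))
    rw [max_eq_left (Fin.le_last l), max_eq_right (Fin.zero_le l)] at this
    rw [← this]
    refine Finset.sum_congr rfl fun j _ => ?_
    split_ifs with hl
    · rw [max_eq_left hl, max_eq_left (hl.trans (Fin.castSucc_lt_succ).le)]
    · have h1 : j.castSucc < l := lt_of_not_ge hl
      rw [max_eq_right h1.le, max_eq_right (Fin.castSucc_lt_iff_succ_le.1 h1), sub_self]
  simp only [mul_add, Finset.sum_add_distrib]
  rw [← Finset.sum_mul, sum_succ_sub_castSucc]
  have h2 : ∑ j : Fin (k + 1), (V j.succ - V j.castSucc) * ∑ l ∈ Finset.Iic j.castSucc, f l =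
      ∑ l, (V (Fin.last _) - V l) * f l := by
    simp only [← h, Finset.sum_mul, Finset.mul_sum]
    rw [Finset.sum_comm]
    refine Finset.sum_congr rfl fun j _ => ?_
    simp only [ite_mul, zero_mul]
    rw [← Finset.sum_filter]
    refine Finset.sum_congr ?_ fun _ _ => rfl
    ext; simp
  rw [h2]
  simp only [sub_mul, Finset.sum_sub_distrib, Finset.mul_sum]
  ring

theorem intervalIntegrable_eval (p : ℝ[X]) (c d : ℝ) :
    IntervalIntegrable (fun t => p.eval t) MeasureTheory.volume c d :=
  p.continuous.intervalIntegrable _ _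

theorem integral_eval_derivative (p : ℝ[X]) (c d : ℝ) :
    ∫ t in c..d, p.derivative.eval t = p.eval d - p.eval c :=
  intervalIntegral.integral_eq_sub_of_hasDerivAt (fun t _ => p.hasDerivAt t)
    (intervalIntegrable_eval _ _ _)

theorem integral_eval_add (p q : ℝ[X]) (c d : ℝ) :
    ∫ t in c..d, (p + q).eval t = (∫ t in c..d, p.eval t) + ∫ t in c..d, q.eval t := by
  simp only [eval_add]
  exact intervalIntegral.integral_add (intervalIntegrable_eval _ _ _)
    (intervalIntegrable_eval _ _ _)

theorem integral_eval_C_mul (r : ℝ) (p : ℝ[X]) (c d : ℝ) :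
    ∫ t in c..d, (C r * p).eval t = r * ∫ t in c..d, p.eval t := by
  simp only [eval_mul, eval_C]
  exact intervalIntegral.integral_const_mul _ _

theorem integral_derivative_mul (p q : ℝ[X]) (c d : ℝ) :
    ∫ t in c..d, (p.derivative * q).eval t = p.eval d * q.eval d - p.eval c * q.eval c -
      ∫ t in c..d, (p * q.derivative).eval t := by
  have h := integral_eval_derivative (p * q) c d
  rw [derivative_mul, integral_eval_add, eval_mul, eval_mul] at h
  linarith

theorem exists_derivative_eq (v : ℝ[X]) : ∃ V : ℝ[X], V.derivative = v := by
  refine ⟨∑ n ∈ Finset.range (v.natDegree + 1), monomial (n + 1) (v.coeff n / (n + 1)), ?_⟩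
  conv_rhs => rw [v.as_sum_range]
  rw [derivative_sum]
  refine Finset.sum_congr rfl fun n _ => ?_
  rw [derivative_monomial, Nat.add_sub_cancel]
  congr 1
  push_cast
  field_simp

theorem coeff_succ_of_derivative_eq {v V : ℝ[X]} (h : V.derivative = v) (n : ℕ) :
    V.coeff (n + 1) = v.coeff n / (n + 1) := by
  rw [← h, coeff_derivative]
  field_simp

theorem natDegree_le_of_derivative_eq {v V : ℝ[X]} {k : ℕ} (h : V.derivative = v)
    (hv : v.degree < (k + 1 : ℕ)) : V.natDegree ≤ k + 1 := by
  rw [natDegree_le_iff_coeff_eq_zero]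
  intro n hn
  obtain ⟨n, rfl⟩ : ∃ m, n = m + 1 := ⟨n - 1, by omega⟩
  rw [coeff_succ_of_derivative_eq h, (degree_lt_iff_coeff_zero _ _).1 hv n (by omega), zero_div]

theorem degree_derivative_lt_two_mul {w : ℝ[X]} {k : ℕ} (hw : w.degree < (k + 1 : ℕ)) :
    w.derivative.degree < ((2 * k : ℕ) : WithBot ℕ) := by
  rw [degree_lt_iff_coeff_zero]
  intro n hn
  rw [coeff_derivative, (degree_lt_iff_coeff_zero _ _).1 hw (n + 1) (by omega), zero_mul]

/-! ### The energy form and the upwind flux on one cell -/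

section Cell

variable {k : ℕ}

/-- The integrals of `v` between consecutive nodes. -/
noncomputable def cvInt (x : Fin (k + 2) → ℝ) (v : ℝ[X]) (j : Fin (k + 1)) : ℝ :=
  ∫ t in x j.castSucc..x j.succ, v.eval t

/-- The piecewise constant test function of `w` on one cell. -/
noncomputable def testValue (x A : Fin (k + 2) → ℝ) (w : ℝ[X]) (j : Fin (k + 1)) : ℝ :=
  w.eval (x 0) + ∑ l ∈ Finset.Iic j.castSucc, A l * w.derivative.eval (x l)

/-- The energy inner product on one cell. -/
noncomputable def cellInner (x A : Fin (k + 2) → ℝ) (v w : ℝ[X]) : ℝ :=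
  ∑ j, cvInt x v j * testValue x A w j

/-- The quadrature error. -/
noncomputable def quadDefect (x A : Fin (k + 2) → ℝ) (p : ℝ[X]) : ℝ :=
  (∫ t in x 0..x (Fin.last _), p.eval t) - ∑ j, A j * p.eval (x j)

/-- Exactness of the quadrature on polynomials of degree less than `2k`. -/
def ExactQuad (x A : Fin (k + 2) → ℝ) : Prop :=
  ∀ p : ℝ[X], p.degree < ((2 * k : ℕ) : WithBot ℕ) →
    ∫ t in x 0..x (Fin.last _), p.eval t = ∑ j, A j * p.eval (x j)

variable {x A : Fin (k + 2) → ℝ}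

/-- The defect is a linear functional vanishing on degrees below `2k`; on degree at most `2k` it
sees only the leading coefficient. -/
theorem quadDefect_eq (hA : ExactQuad x A) {p : ℝ[X]} (hp : p.natDegree ≤ 2 * k) :
    quadDefect x A p = p.coeff (2 * k) * quadDefect x A (X ^ (2 * k)) := by
  set r := p + C (-p.coeff (2 * k)) * X ^ (2 * k) with hr
  have hdeg : r.degree < ((2 * k : ℕ) : WithBot ℕ) := by
    rw [degree_lt_iff_coeff_zero]
    intro n hn
    rw [hr, coeff_add, coeff_C_mul, coeff_X_pow]
    split_ifs with h
    · rw [h]; ring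
    · rw [coeff_eq_zero_of_natDegree_lt (by omega)]; ring
  have h0 := hA r hdeg
  rw [hr, integral_eval_add, integral_eval_C_mul] at h0
  simp only [eval_add, eval_mul, eval_C, mul_add, Finset.sum_add_distrib] at h0
  have h1 : ∑ j, A j * (-p.coeff (2 * k) * (X ^ (2 * k) : ℝ[X]).eval (x j)) =
      -p.coeff (2 * k) * ∑ j, A j * (X ^ (2 * k) : ℝ[X]).eval (x j) := by
    rw [Finset.mul_sum]
    exact Finset.sum_congr rfl fun _ _ => by ring
  rw [h1] at h0
  simp only [quadDefect]
  linarith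

theorem eval_add_sum_mul_derivative (hA : ExactQuad x A) {w : ℝ[X]}
    (hw : w.degree < (k + 1 : ℕ)) :
    w.eval (x 0) + ∑ l, A l * w.derivative.eval (x l) = w.eval (x (Fin.last _)) := by
  rw [← hA _ (degree_derivative_lt_two_mul hw), integral_eval_derivative]
  ring

/-- Let `V' = v`. Summation by parts gives boundary terms minus the quadrature of `V w'`, while
integration by parts gives the same boundary terms minus its integral. The two differ by the defect
of `V w'`, which has degree at most `2k` and leading coefficient `v_k w_k k/(k+1)`. -/
theorem cellInner_eq (hA : ExactQuad x A) {v w : ℝ[X]} (hv : v.degree < (k + 1 : ℕ))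
    (hw : w.degree < (k + 1 : ℕ)) :
    cellInner x A v w = (∫ t in x 0..x (Fin.last _), (v * w).eval t) +
      v.coeff k * w.coeff k * (k / (k + 1)) * quadDefect x A (X ^ (2 * k)) := by
  obtain ⟨V, hV⟩ := exists_derivative_eq v
  have h1 : cellInner x A v w = V.eval (x (Fin.last _)) * w.eval (x (Fin.last _)) -
      V.eval (x 0) * w.eval (x 0) - ∑ l, A l * (V * w.derivative).eval (x l) := by
    rw [cellInner]
    simp only [cvInt, testValue, ← hV, integral_eval_derivative]
    rw [sum_mul_partial_sum (fun j => V.eval (x j)), eval_add_sum_mul_derivative hA hw]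
    congr 1
    refine Finset.sum_congr rfl fun l _ => ?_
    rw [eval_mul]; ring
  have h2 : quadDefect x A (V * w.derivative) =
      v.coeff k * w.coeff k * (k / (k + 1)) * quadDefect x A (X ^ (2 * k)) := by
    have hVd := natDegree_le_of_derivative_eq hV hv
    have hwd : w.natDegree ≤ k := by
      rw [natDegree_le_iff_coeff_eq_zero]
      exact fun n hn => (degree_lt_iff_coeff_zero _ _).1 hw n hn
    rcases Nat.eq_zero_or_pos k with hk | hk
    · have : w.derivative = 0 := derivative_of_natDegree_zero (by omega)
      simp [this, hk, quadDefect]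
    · obtain ⟨m, rfl⟩ : ∃ m, k = m + 1 := ⟨k - 1, by omega⟩
      have hwd' : w.derivative.natDegree ≤ m := (natDegree_derivative_le w).trans (by omega)
      rw [quadDefect_eq hA (natDegree_mul_le.trans (by omega)),
        show 2 * (m + 1) = (m + 1 + 1) + m by ring,
        coeff_mul_add_eq_of_natDegree_le hVd hwd', coeff_succ_of_derivative_eq hV, coeff_derivative]
      push_cast
      ring
  have h3 := integral_derivative_mul V w (x 0) (x (Fin.last _))
  rw [hV] at h3
  rw [← h2, h1, h3, quadDefect]
  ring

theorem cellInner_comm (hA : ExactQuad x A) {v w : ℝ[X]} (hv : v.degree < (k + 1 : ℕ))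
    (hw : w.degree < (k + 1 : ℕ)) : cellInner x A v w = cellInner x A w v := by
  rw [cellInner_eq hA hv hw, cellInner_eq hA hw hv, mul_comm v w]
  ring

/-- The dissipation identity of the upwind flux on one cell with inflow value `z`. -/
theorem sum_flux_mul_testValue (hA : ExactQuad x A) (hA0 : A 0 = 0) {u : ℝ[X]}
    (hu : u.degree < (k + 1 : ℕ)) (z : ℝ) {U : Fin (k + 2) → ℝ} (hU0 : U 0 = z)
    (hU : ∀ j, j ≠ 0 → U j = u.eval (x j)) :
    ∑ j : Fin (k + 1), (U j.castSucc - U j.succ) * testValue x A u j =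
      z * u.eval (x 0) - (u.eval (x (Fin.last _)) ^ 2 + u.eval (x 0) ^ 2) / 2 := by
  have h1 : ∑ j : Fin (k + 1), (U j.castSucc - U j.succ) * testValue x A u j =
      -∑ j : Fin (k + 1), (U j.succ - U j.castSucc) * testValue x A u j := by
    rw [← Finset.sum_neg_distrib]
    exact Finset.sum_congr rfl fun _ _ => by ring
  rw [h1]
  simp only [testValue]
  rw [sum_mul_partial_sum U (fun l => A l * u.derivative.eval (x l)),
    eval_add_sum_mul_derivative hA hu, hU _ (Fin.last_pos).ne', hU0]
  have h2 : ∑ l, U l * (A l * u.derivative.eval (x l)) =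
      ∑ l, A l * (u * u.derivative).eval (x l) := by
    refine Finset.sum_congr rfl fun l _ => ?_
    -- At the left end the flux value is the inflow `z`, not the trace of `u`. The zero weight there
    -- lets one replace the other.
    by_cases hl : l = 0
    · simp [hl, hA0]
    · rw [hU l hl, eval_mul]; ring
  -- Exactness up to degree `2k - 1` is just what `u u'` needs, so the sum becomes the integral of
  -- `(u²/2)'`.
  have hdeg : (u * u.derivative).degree < ((2 * k : ℕ) : WithBot ℕ) := by
    have hwd : u.natDegree ≤ k := by
      rw [natDegree_le_iff_coeff_eq_zero]
      exact fun n hn => (degree_lt_iff_coeff_zero _ _).1 hu n hn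
    rcases Nat.eq_zero_or_pos k with hk | hk
    · have : u.derivative = 0 := derivative_of_natDegree_zero (by omega)
      rw [this, mul_zero, degree_zero]
      exact WithBot.bot_lt_coe _
    · refine lt_of_le_of_lt (degree_le_natDegree) ?_
      have := natDegree_derivative_le u
      have := natDegree_mul_le (p := u) (q := u.derivative)
      exact_mod_cast (by omega)
  rw [h2, ← hA _ hdeg]
  have h3 := integral_derivative_mul u u (x 0) (x (Fin.last _))
  rw [mul_comm u.derivative u] at h3
  linarith

/-- An antiderivative has degree at most `k + 1` and takes one value at all `k + 2` nodes, hence is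
constant. This makes the scheme well posed as an evolution in the trial space. -/
theorem eq_zero_of_cvInt_eq_zero (hx : StrictMono x) {v : ℝ[X]} (hv : v.degree < (k + 1 : ℕ))
    (h : ∀ j, cvInt x v j = 0) : v = 0 := by
  obtain ⟨V, hV⟩ := exists_derivative_eq v
  have hconst : ∀ j, V.eval (x j) = V.eval (x 0) := by
    intro j
    induction j using Fin.induction with
    | zero => rfl
    | succ j ih =>
      have := h j
      rw [cvInt, ← hV, integral_eval_derivative] at this
      linarith
  have h0 : V - C (V.eval (x 0)) = 0 := by
    refine eq_zero_of_natDegree_lt_card_of_eval_eq_zero _ hx.injective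
      (fun j => by simp [hconst j]) ?_
    rw [natDegree_sub_C, Fintype.card_fin]
    exact Nat.lt_succ_of_le (natDegree_le_of_derivative_eq hV hv)
  rw [← hV, sub_eq_zero.1 h0, derivative_C]

end Cell

/-! ### Legendre polynomials on the unit interval -/

/-- The shifted Legendre polynomial with real coefficients. -/
noncomputable def legendreP (n : ℕ) : ℝ[X] := (shiftedLegendre n).map (Int.castRingHom ℝ)

theorem coeff_legendreP (n j : ℕ) :
    (legendreP n).coeff j = (-1) ^ j * n.choose j * (n + j).choose n := by
  simp [legendreP, coeff_shiftedLegendre]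

theorem coeff_legendreP_self (n : ℕ) :
    (legendreP n).coeff n = (-1) ^ n * n.centralBinom := by
  rw [coeff_legendreP, Nat.choose_self, Nat.centralBinom, two_mul]
  simp

theorem natDegree_legendreP_le (n : ℕ) : (legendreP n).natDegree ≤ n :=
  natDegree_map_le.trans (natDegree_shiftedLegendre n).le

theorem eval_zero_legendreP (n : ℕ) : (legendreP n).eval 0 = 1 := by
  rw [← coeff_zero_eq_eval_zero, coeff_legendreP]
  simp

theorem eval_one_legendreP_sq (n : ℕ) : (legendreP n).eval 1 ^ 2 = 1 := by
  have h := shiftedLegendre_eval_symm n (1 : ℝ)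
  have e (y : ℝ) : aeval y (shiftedLegendre n) = (legendreP n).eval y := by
    rw [legendreP, eval_map, aeval_def]; rfl
  rw [e, e, sub_self, eval_zero_legendreP] at h
  rw [h, mul_one, ← pow_mul, mul_comm, pow_mul]
  simp

/-- Repeated integration by parts: each derivative lost by `F` lowers the degree of `q`, and the
boundary terms vanish because fewer than `m` derivatives leave a factor `X(1 - X)`. -/
theorem integral_iterate_derivative_mul_eq_zero (m : ℕ) {F q : ℝ[X]}
    (hF : (X * (1 - X)) ^ m ∣ F) (hq : q.degree < m) :
    ∫ t in (0 : ℝ)..1, (derivative^[m] F * q).eval t = 0 := by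
  induction m generalizing q with
  | zero =>
    have : q = 0 := by
      rw [← degree_eq_bot]
      exact Nat.WithBot.lt_zero_iff.1 (by exact_mod_cast hq)
    simp [this]
  | succ m ih =>
    have hdvd : X * (1 - X) ∣ derivative^[m] F := by
      have := pow_sub_dvd_iterate_derivative_of_pow_dvd m hF
      simpa using this
    obtain ⟨G, hG⟩ := hdvd
    have h0 : (derivative^[m] F).eval 0 = 0 := by simp [hG]
    have h1 : (derivative^[m] F).eval 1 = 0 := by simp [hG]
    rw [Function.iterate_succ_apply', integral_derivative_mul, h0, h1,
      ih (dvd_trans (pow_dvd_pow _ (Nat.le_succ m)) hF)]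
    · ring
    · rw [degree_lt_iff_coeff_zero] at hq ⊢
      intro n hn
      rw [coeff_derivative, hq _ (by omega), zero_mul]

theorem integral_legendreP_mul_eq_zero (n : ℕ) {q : ℝ[X]} (hq : q.degree < n) :
    ∫ t in (0 : ℝ)..1, (legendreP n * q).eval t = 0 := by
  have h := congrArg (Polynomial.map (Int.castRingHom ℝ)) (factorial_mul_shiftedLegendre_eq n)
  rw [Polynomial.map_mul, ← iterate_derivative_map] at h
  simp only [Polynomial.map_mul, Polynomial.map_pow, Polynomial.map_sub, Polynomial.map_one,
    map_X, Polynomial.map_natCast] at h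
  have h2 := integral_iterate_derivative_mul_eq_zero n
    (F := X ^ n * (1 - X) ^ n) (by rw [mul_pow]) hq
  rw [← h, ← C_eq_natCast, mul_assoc, integral_eval_C_mul] at h2
  exact (mul_eq_zero.1 h2).resolve_left (by exact_mod_cast n.factorial_ne_zero)

/-- With `w = X p' - n p`, one has `(X p²)' = (2n + 1) p² + 2 p w`. The leading terms of `w` cancel,
so `w` is orthogonal to `p`, and `X p²` is `1` at the right end and `0` at the left. -/
theorem integral_legendreP_sq (n : ℕ) :
    ∫ t in (0 : ℝ)..1, (legendreP n * legendreP n).eval t = 1 / (2 * n + 1) := by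
  set p := legendreP n with hp
  set w := X * p.derivative - C (n : ℝ) * p with hw
  have hwdeg : w.degree < n := by
    rw [degree_lt_iff_coeff_zero]
    intro j hj
    rcases Nat.eq_zero_or_pos j with h0 | h0
    · obtain rfl : n = 0 := by omega
      simp [hw, h0]
    · obtain ⟨i, rfl⟩ : ∃ i, j = i + 1 := ⟨j - 1, by omega⟩
      rw [hw, coeff_sub, coeff_X_mul, coeff_C_mul, coeff_derivative]
      rcases hj.eq_or_lt with h | h
      · rw [h]; push_cast; ring
      · rw [coeff_eq_zero_of_natDegree_lt (lt_of_le_of_lt (natDegree_legendreP_le n) h)]; ring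
  have h1 := integral_eval_derivative (X * (p * p)) 0 1
  have h2 : derivative (X * (p * p)) = C (2 * n + 1 : ℝ) * (p * p) + C 2 * (p * w) := by
    rw [hw, derivative_mul, derivative_mul, derivative_X]
    simp only [map_add, map_mul, map_one]
    rw [show (C 2 : ℝ[X]) = 2 from rfl]
    ring
  have h0 : ∫ t in (0 : ℝ)..1, (p * w).eval t = 0 := integral_legendreP_mul_eq_zero n hwdeg
  have h3 : (X * (p * p)).eval 1 = 1 := by
    rw [eval_mul, eval_mul, eval_X, ← sq, eval_one_legendreP_sq, mul_one]
  have h5 : (X * (p * p)).eval 0 = 0 := by rw [eval_mul, eval_X, zero_mul]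
  rw [h2, integral_eval_add, integral_eval_C_mul, integral_eval_C_mul, h0, h3, h5] at h1
  have h4 : (2 * n + 1 : ℝ) ≠ 0 := by positivity
  rw [eq_div_iff h4]
  linarith

theorem integral_sq_pos {w : ℝ[X]} (hw : w ≠ 0) : 0 < ∫ t in (0 : ℝ)..1, (w * w).eval t := by
  refine intervalIntegral.integral_pos zero_lt_one (w * w).continuous.continuousOn
    (fun t _ => by rw [eval_mul]; exact mul_self_nonneg _) ?_
  by_contra! h
  refine hw (eq_zero_of_infinite_isRoot w ((Set.Icc_infinite zero_lt_one).mono fun t ht => ?_))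
  have := h t ht
  rw [eval_mul] at this
  exact mul_self_eq_zero.1 (le_antisymm this (mul_self_nonneg _))

/-! ### Positivity of the energy form on the unit cell -/

/-- The assumptions on the nodes and weights in the unit cell. -/
structure RefAdmissible {k : ℕ} (ξ A : Fin (k + 2) → ℝ) : Prop where
  strictMono : StrictMono ξ
  first : ξ 0 = 0
  last : ξ (Fin.last _) = 1
  exact_quad : ExactQuad ξ A
  pos : 1 ≤ k → 0 < 1 / (2 * k - 1 : ℝ) -
    ∑ j, A j * (legendreP (k + 1) * legendreP (k - 1)).eval (ξ j)
  upwind : A 0 = 0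

/-- Split `v = α L_k + w` with `deg w < k`. Since `L_{k+1}` and `L_{k-1}` are orthogonal, the
quadrature of their product is minus its defect, and so measures the defect of `X^(2k)`. For `k ≥ 1`
the energy is then `α² (2k-1)/(2k+1)` times the quantity assumed positive, plus `∫ w²`. -/
theorem RefAdmissible.cellInner_pos {k : ℕ} {ξ A : Fin (k + 2) → ℝ} (h : RefAdmissible ξ A)
    {v : ℝ[X]} (hv : v.degree < (k + 1 : ℕ)) (hv0 : v ≠ 0) : 0 < cellInner ξ A v v := by
  rw [cellInner_eq h.exact_quad hv hv, h.first, h.last]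
  rcases Nat.eq_zero_or_pos k with rfl | hk
  · simpa using integral_sq_pos hv0
  set E₀ := quadDefect ξ A (X ^ (2 * k)) with hE₀
  have hc : (legendreP k).coeff k ≠ 0 := by
    rw [coeff_legendreP_self]
    have := Nat.centralBinom_ne_zero k
    simp [this]
  set α := v.coeff k / (legendreP k).coeff k with hα
  have hvk : v.coeff k = α * (legendreP k).coeff k := by rw [hα]; field_simp
  set w := v - C α * legendreP k with hw
  have hwdeg : w.degree < k := by
    rw [degree_lt_iff_coeff_zero]
    intro j hj
    rw [hw, coeff_sub, coeff_C_mul]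
    rcases hj.eq_or_lt with rfl | hj
    · rw [hvk, sub_self]
    · rw [(degree_lt_iff_coeff_zero _ _).1 hv j hj,
        coeff_eq_zero_of_natDegree_lt (lt_of_le_of_lt (natDegree_legendreP_le k) hj)]
      ring
  have hint : ∫ t in (0 : ℝ)..1, (v * v).eval t =
      α ^ 2 / (2 * k + 1) + ∫ t in (0 : ℝ)..1, (w * w).eval t := by
    have : v * v = C (α ^ 2) * (legendreP k * legendreP k) + C (2 * α) * (legendreP k * w) +
        w * w := by
      have : v = C α * legendreP k + w := by rw [hw]; ring
      rw [this]
      simp only [map_mul, map_pow]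
      rw [show (C 2 : ℝ[X]) = 2 from rfl]
      ring
    rw [this, integral_eval_add, integral_eval_add, integral_eval_C_mul, integral_eval_C_mul,
      integral_legendreP_sq, integral_legendreP_mul_eq_zero k hwdeg]
    ring
  obtain ⟨m, rfl⟩ : ∃ m, k = m + 1 := ⟨k - 1, by omega⟩
  have hpos := h.pos (by omega)
  rw [Nat.add_sub_cancel] at hpos
  have hdef : quadDefect ξ A (legendreP (m + 1 + 1) * legendreP m) =
      (m + 1 + 1).centralBinom * m.centralBinom * E₀ := by
    have d1 := natDegree_legendreP_le (m + 1 + 1)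
    have d2 := natDegree_legendreP_le m
    rw [quadDefect_eq h.exact_quad (natDegree_mul_le.trans (by omega)),
      show 2 * (m + 1) = (m + 1 + 1) + m by ring, coeff_mul_add_eq_of_natDegree_le d1 d2,
      coeff_legendreP_self, coeff_legendreP_self, show m + 1 + 1 + m = 2 * (m + 1) by ring, ← hE₀]
    have : (-1 : ℝ) ^ (m + 1 + 1) * (-1) ^ m = 1 := by
      rw [← pow_add, show m + 1 + 1 + m = 2 * (m + 1) by ring, pow_mul]; simp
    linear_combination (((m + 1 + 1).centralBinom : ℝ) * m.centralBinom * E₀) * this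
  have horth : ∫ t in (0 : ℝ)..1, (legendreP (m + 1 + 1) * legendreP m).eval t = 0 :=
    integral_legendreP_mul_eq_zero _ (lt_of_le_of_lt (degree_le_of_natDegree_le
      (natDegree_legendreP_le m)) (by exact_mod_cast (by omega)))
  rw [quadDefect, h.first, h.last, horth] at hdef
  have r1 : ((m : ℝ) + 1 + 1) * (m + 1 + 1).centralBinom =
      2 * (2 * (m + 1) + 1) * (m + 1).centralBinom := by
    exact_mod_cast Nat.succ_mul_centralBinom_succ (m + 1)
  have r2 : ((m : ℝ) + 1) * (m + 1).centralBinom = 2 * (2 * m + 1) * m.centralBinom := by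
    exact_mod_cast Nat.succ_mul_centralBinom_succ m
  set c2 : ℝ := ((m + 1 + 1).centralBinom : ℝ)
  set c1 : ℝ := ((m + 1).centralBinom : ℝ) with hc1
  set c0 : ℝ := (m.centralBinom : ℝ)
  have hsq : (legendreP (m + 1)).coeff (m + 1) ^ 2 = c1 ^ 2 := by
    rw [coeff_legendreP_self, mul_pow, ← pow_mul, mul_comm (m + 1), pow_mul]; simp [hc1]
  -- Leading coefficients are central binomials up to sign. Their recursion converts the square for
  -- degree `k` into the product for degrees `k + 1` and `k - 1`.
  have hratio : c1 ^ 2 * ((m + 1) / (m + 1 + 1)) =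
      (2 * m + 1) / (2 * (m + 1) + 1) * (c2 * c0) := by
    have e1 : c2 = 2 * (2 * (m + 1) + 1) * c1 / (m + 1 + 1) := by
      rw [eq_div_iff (by positivity)]; linarith
    have e0 : c0 = (m + 1) * c1 / (2 * (2 * m + 1)) := by
      rw [eq_div_iff (by positivity)]; linarith
    rw [e1, e0]
    field_simp
  have hform : v.coeff (m + 1) * v.coeff (m + 1) * (((m + 1 : ℕ) : ℝ) / ((m + 1 : ℕ) + 1)) * E₀ =
      α ^ 2 * ((2 * m + 1) / (2 * (m + 1) + 1)) * (c2 * c0 * E₀) := by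
    rw [hvk]
    push_cast
    linear_combination (α ^ 2 * ((m + 1 : ℝ) / (m + 1 + 1)) * E₀) * hsq + α ^ 2 * E₀ * hratio
  rw [hint, hform]
  push_cast at hpos ⊢
  have hpos' : 0 < 1 / (2 * m + 1 : ℝ) + c2 * c0 * E₀ := by
    rw [show (2 * (m + 1) - 1 : ℝ) = 2 * m + 1 by ring] at hpos
    linarith
  have hcomb : α ^ 2 / (2 * (m + 1) + 1) + (∫ t in (0 : ℝ)..1, (w * w).eval t) +
      α ^ 2 * ((2 * m + 1) / (2 * (m + 1) + 1)) * (c2 * c0 * E₀) =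
      α ^ 2 * ((2 * m + 1) / (2 * (m + 1) + 1)) * (1 / (2 * m + 1 : ℝ) + c2 * c0 * E₀) +
        ∫ t in (0 : ℝ)..1, (w * w).eval t := by
    field_simp
    ring
  rw [hcomb]
  by_cases hw0 : w = 0
  · have hα0 : α ≠ 0 := by
      rintro h0
      apply hv0
      have : v = C α * legendreP (m + 1) + w := by rw [hw]; ring
      rw [this, hw0, h0]; simp
    rw [hw0]
    simp only [mul_zero, eval_zero, intervalIntegral.integral_zero, add_zero]
    positivity
  · have := integral_sq_pos hw0
    positivity

/-! ### Norm equivalences, uniform over the reference patterns -/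

/-- The inner product space structure given by a positive definite symmetric bilinear form. -/
@[reducible] def coreOfPosDef {V : Type*} [AddCommGroup V] [Module ℝ V] (B : V →ₗ[ℝ] V →ₗ[ℝ] ℝ)
    (hsymm : ∀ v w, B v w = B w v) (hpos : ∀ v, v ≠ 0 → 0 < B v v) :
    InnerProductSpace.Core ℝ V where
  inner v w := B v w
  conj_inner_symm v w := hsymm w v
  re_inner_nonneg v := by
    by_cases hv : v = 0
    · simp [hv]
    · exact (hpos v hv).le
  add_left v w z := by simp
  smul_left v w r := by simp
  definite v hv := by
    by_contra h
    exact (hpos v h).ne' hv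

/-- In finite dimension a linear functional is bounded for the norm defined by `B`; the constant is
its squared operator norm. -/
theorem exists_sq_le_of_posDef {V : Type*} [AddCommGroup V] [Module ℝ V] [FiniteDimensional ℝ V]
    (B : V →ₗ[ℝ] V →ₗ[ℝ] ℝ) (hsymm : ∀ v w, B v w = B w v) (hpos : ∀ v, v ≠ 0 → 0 < B v v)
    (φ : V →ₗ[ℝ] ℝ) : ∃ C, 0 ≤ C ∧ ∀ v, φ v ^ 2 ≤ C * B v v := by
  let core := coreOfPosDef B hsymm hpos
  let : NormedAddCommGroup V := core.toNormedAddCommGroup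
  let : InnerProductSpace ℝ V := InnerProductSpace.ofCore core.toCore
  refine ⟨‖LinearMap.toContinuousLinearMap φ‖ ^ 2, by positivity, fun v => ?_⟩
  have h1 := (LinearMap.toContinuousLinearMap φ).le_opNorm v
  have h2 : B v v = ‖v‖ ^ 2 := real_inner_self_eq_norm_sq v
  rw [h2, ← mul_pow, ← sq_abs]
  exact pow_le_pow_left₀ (abs_nonneg _) h1 2

section Cell

variable {k : ℕ}

theorem cvInt_add (x : Fin (k + 2) → ℝ) (v w : ℝ[X]) (j : Fin (k + 1)) :
    cvInt x (v + w) j = cvInt x v j + cvInt x w j := integral_eval_add _ _ _ _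

theorem cvInt_smul (x : Fin (k + 2) → ℝ) (r : ℝ) (v : ℝ[X]) (j : Fin (k + 1)) :
    cvInt x (r • v) j = r * cvInt x v j := by
  rw [smul_eq_C_mul]; exact integral_eval_C_mul _ _ _ _

theorem testValue_add (x A : Fin (k + 2) → ℝ) (v w : ℝ[X]) (j : Fin (k + 1)) :
    testValue x A (v + w) j = testValue x A v j + testValue x A w j := by
  simp only [testValue, derivative_add, eval_add, mul_add, Finset.sum_add_distrib]
  ring

theorem testValue_smul (x A : Fin (k + 2) → ℝ) (r : ℝ) (v : ℝ[X]) (j : Fin (k + 1)) :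
    testValue x A (r • v) j = r * testValue x A v j := by
  simp only [testValue, derivative_smul, eval_smul, smul_eq_mul, mul_add, Finset.mul_sum]
  congr 1
  exact Finset.sum_congr rfl fun _ _ => by ring

theorem cellInner_add_left (x A : Fin (k + 2) → ℝ) (u v w : ℝ[X]) :
    cellInner x A (u + v) w = cellInner x A u w + cellInner x A v w := by
  simp only [cellInner, cvInt_add, add_mul, Finset.sum_add_distrib]

theorem cellInner_smul_left (x A : Fin (k + 2) → ℝ) (r : ℝ) (v w : ℝ[X]) :
    cellInner x A (r • v) w = r * cellInner x A v w := by
  simp only [cellInner, cvInt_smul, mul_assoc, Finset.mul_sum]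

theorem cellInner_add_right (x A : Fin (k + 2) → ℝ) (u v w : ℝ[X]) :
    cellInner x A u (v + w) = cellInner x A u v + cellInner x A u w := by
  simp only [cellInner, testValue_add, mul_add, Finset.sum_add_distrib]

theorem cellInner_smul_right (x A : Fin (k + 2) → ℝ) (r : ℝ) (v w : ℝ[X]) :
    cellInner x A v (r • w) = r * cellInner x A v w := by
  simp only [cellInner, testValue_smul, Finset.mul_sum]
  exact Finset.sum_congr rfl fun _ _ => by ring

/-- The integrals over the control volumes as linear functionals. -/
noncomputable def cvIntLin (x : Fin (k + 2) → ℝ) (j : Fin (k + 1)) :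
    degreeLT ℝ (k + 1) →ₗ[ℝ] ℝ where
  toFun v := cvInt x v j
  map_add' v w := cvInt_add x v w j
  map_smul' r v := cvInt_smul x r v j

/-- The values of the test function as linear functionals. -/
noncomputable def testValueLin (x A : Fin (k + 2) → ℝ) (j : Fin (k + 1)) :
    degreeLT ℝ (k + 1) →ₗ[ℝ] ℝ where
  toFun v := testValue x A v j
  map_add' v w := testValue_add x A v w j
  map_smul' r v := testValue_smul x A r v j

/-- The energy inner product on a cell as a bilinear form. -/
noncomputable def cellForm (x A : Fin (k + 2) → ℝ) :
    degreeLT ℝ (k + 1) →ₗ[ℝ] degreeLT ℝ (k + 1) →ₗ[ℝ] ℝ :=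
  LinearMap.mk₂ ℝ (fun v w => cellInner x A v w)
    (fun _ _ _ => cellInner_add_left _ _ _ _ _) (fun _ _ _ => cellInner_smul_left _ _ _ _ _)
    (fun _ _ _ => cellInner_add_right _ _ _ _ _) (fun _ _ _ => cellInner_smul_right _ _ _ _ _)

/-- The inner product of the control volume integrals. -/
noncomputable def cvForm (x : Fin (k + 2) → ℝ) :
    degreeLT ℝ (k + 1) →ₗ[ℝ] degreeLT ℝ (k + 1) →ₗ[ℝ] ℝ :=
  LinearMap.mk₂ ℝ (fun v w => ∑ j, cvIntLin x j v * cvIntLin x j w)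
    (fun _ _ _ => by simp only [map_add, add_mul, Finset.sum_add_distrib])
    (fun _ _ _ => by simp only [map_smul, smul_eq_mul, mul_assoc, Finset.mul_sum])
    (fun _ _ _ => by simp only [map_add, mul_add, Finset.sum_add_distrib])
    (fun _ _ _ => by
      simp only [map_smul, smul_eq_mul, Finset.mul_sum]
      exact Finset.sum_congr rfl fun _ _ => by ring)

theorem cvForm_apply (x : Fin (k + 2) → ℝ) (v w : degreeLT ℝ (k + 1)) :
    cvForm x v w = ∑ j, cvInt x v j * cvInt x w j := rfl

theorem cvForm_pos {x : Fin (k + 2) → ℝ} (hx : StrictMono x) (v : degreeLT ℝ (k + 1))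
    (hv : v ≠ 0) : 0 < cvForm x v v := by
  rw [cvForm_apply]
  refine lt_of_le_of_ne (Finset.sum_nonneg fun _ _ => mul_self_nonneg _) fun h => hv ?_
  rw [eq_comm, Finset.sum_eq_zero_iff_of_nonneg fun _ _ => mul_self_nonneg _] at h
  exact Subtype.ext (eq_zero_of_cvInt_eq_zero hx (mem_degreeLT.1 v.2)
    fun j => mul_self_eq_zero.1 (h j (Finset.mem_univ _)))

variable {ξ A A' : Fin (k + 2) → ℝ}

/-- Point values are controlled by the energy form. Test values are controlled by the positive
definite form of control-volume integrals, which bounds the energy above. These are the two halves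
of the inverse estimate. -/
theorem RefAdmissible.exists_bounds (h : RefAdmissible ξ A) :
    ∃ C, 0 ≤ C ∧ ∀ v : ℝ[X], v.degree < (k + 1 : ℕ) →
      (∀ j, v.eval (ξ j) ^ 2 ≤ C * cellInner ξ A v v) ∧
      cellInner ξ A v v ≤ C * ∑ j, cvInt ξ v j ^ 2 := by
  have hsymm (v w : degreeLT ℝ (k + 1)) : cellForm ξ A v w = cellForm ξ A w v :=
    cellInner_comm h.exact_quad (mem_degreeLT.1 v.2) (mem_degreeLT.1 w.2)
  have hpos (v : degreeLT ℝ (k + 1)) (hv : v ≠ 0) : 0 < cellForm ξ A v v :=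
    h.cellInner_pos (mem_degreeLT.1 v.2) fun h0 => hv (Subtype.ext h0)
  have hsymm' (v w : degreeLT ℝ (k + 1)) : cvForm ξ v w = cvForm ξ w v := by
    simp only [cvForm_apply, mul_comm]
  choose C₁ hC₁ h₁ using fun j => exists_sq_le_of_posDef (cellForm ξ A) hsymm hpos
    ((leval (ξ j)).comp (degreeLT ℝ (k + 1)).subtype)
  choose C₂ hC₂ h₂ using fun j => exists_sq_le_of_posDef (cvForm ξ) hsymm'
    (cvForm_pos h.strictMono) (testValueLin ξ A j)
  have hS₁ : 0 ≤ ∑ j, C₁ j := Finset.sum_nonneg fun j _ => hC₁ j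
  have hS₂ : 0 ≤ ∑ j, C₂ j := Finset.sum_nonneg fun j _ => hC₂ j
  refine ⟨∑ j, C₁ j + (1 + ∑ j, C₂ j), by positivity, fun v hv => ⟨fun j => ?_, ?_⟩⟩
  · have h3 := h₁ j ⟨v, mem_degreeLT.2 hv⟩
    refine h3.trans (mul_le_mul_of_nonneg_right ?_ ?_)
    · have := Finset.single_le_sum (fun j _ => hC₁ j) (Finset.mem_univ j)
      linarith
    · by_cases h0 : (⟨v, mem_degreeLT.2 hv⟩ : degreeLT ℝ (k + 1)) = 0
      · rw [h0]; simp
      · exact (hpos _ h0).le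
  · set S := ∑ j, cvInt ξ v j ^ 2 with hS
    have hS0 : 0 ≤ S := Finset.sum_nonneg fun _ _ => sq_nonneg _
    have hm : ∑ j, testValue ξ A v j ^ 2 ≤ (∑ j, C₂ j) * S := by
      rw [Finset.sum_mul]
      refine Finset.sum_le_sum fun j _ => (h₂ j ⟨v, mem_degreeLT.2 hv⟩).trans (le_of_eq ?_)
      congr 1
      rw [cvForm_apply, hS]
      exact Finset.sum_congr rfl fun _ _ => (sq _).symm
    have hle : cellInner ξ A v v ≤ ∑ j, (cvInt ξ v j ^ 2 + testValue ξ A v j ^ 2) :=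
      Finset.sum_le_sum fun j _ => by
        nlinarith [sq_nonneg (cvInt ξ v j - testValue ξ A v j), sq_nonneg (cvInt ξ v j),
          sq_nonneg (testValue ξ A v j)]
    rw [Finset.sum_add_distrib, ← hS] at hle
    have : 0 ≤ (∑ j, C₁ j) * S := by positivity
    linarith

/-- The quadrature weights are determined by the nodes. -/
theorem RefAdmissible.weights_unique (h : RefAdmissible ξ A) (h' : RefAdmissible ξ A')
    (hk : 1 ≤ k) : A = A' := by
  funext j
  by_cases hj : j = 0
  · rw [hj, h.upwind, h'.upwind]
  -- The product over the nodes other than the left end and `j` has degree `k ≤ 2k - 1`, so the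
  -- quadrature is exact on it. It isolates the weight at `j`, since the left weight is zero.
  set s : Finset (Fin (k + 2)) := (Finset.univ.erase 0).erase j with hs
  have hcard : s.card = k := by
    rw [hs, Finset.card_erase_of_mem (by simp [hj]), Finset.card_erase_of_mem (by simp)]
    simp
  set p : ℝ[X] := ∏ l ∈ s, (X - C (ξ l)) with hp
  have hdeg : p.degree < ((2 * k : ℕ) : WithBot ℕ) := by
    refine lt_of_le_of_lt degree_le_natDegree ?_
    rw [hp, natDegree_finsetProd_X_sub_C_eq_card, hcard]
    exact_mod_cast (by omega)
  have heq : ∑ l, (A l - A' l) * p.eval (ξ l) = 0 := by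
    simp only [sub_mul, Finset.sum_sub_distrib]
    rw [← h.exact_quad p hdeg, ← h'.exact_quad p hdeg, sub_self]
  rw [Finset.sum_eq_single j] at heq
  · have hne : p.eval (ξ j) ≠ 0 := by
      rw [hp, eval_prod, Finset.prod_ne_zero_iff]
      intro l hl
      rw [eval_sub, eval_X, eval_C, sub_ne_zero]
      exact h.strictMono.injective.ne (Finset.ne_of_mem_erase hl).symm
    exact sub_eq_zero.1 ((mul_eq_zero.1 heq).resolve_right hne)
  · intro l _ hlj
    by_cases hl : l = 0
    · rw [hl, h.upwind, h'.upwind, sub_self, zero_mul]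
    · have : p.eval (ξ l) = 0 := by
        rw [hp, eval_prod]
        exact Finset.prod_eq_zero (i := l) (by simp [hs, hl, hlj]) (by simp)
      rw [this, mul_zero]
  · simp

/-- The form depends on the nodes only: for `k = 0` the weights multiply a zero derivative,
otherwise they are unique. This keeps the weights out of the constants. -/
theorem RefAdmissible.cellInner_congr (h : RefAdmissible ξ A) (h' : RefAdmissible ξ A')
    (v : ℝ[X]) {w : ℝ[X]} (hw : w.degree < (k + 1 : ℕ)) :
    cellInner ξ A v w = cellInner ξ A' v w := by
  rcases Nat.eq_zero_or_pos k with rfl | hk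
  · have : w.derivative = 0 := derivative_of_natDegree_zero (by
      rw [natDegree_eq_zero_iff_degree_le_zero]
      exact Nat.WithBot.lt_one_iff_le_zero.1 (by exact_mod_cast hw))
    simp [cellInner, testValue, this]
  · rw [h.weights_unique h' hk]

/-- Norm equivalence constants uniform over finitely many reference patterns. -/
theorem exists_uniform_bounds (P : Finset (Fin (k + 2) → ℝ)) :
    ∃ C, 0 ≤ C ∧ ∀ ξ ∈ P, ∀ A, RefAdmissible ξ A → ∀ v : ℝ[X], v.degree < (k + 1 : ℕ) →
      0 ≤ cellInner ξ A v v ∧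
      (∀ j, v.eval (ξ j) ^ 2 ≤ C * cellInner ξ A v v) ∧
      cellInner ξ A v v ≤ C * ∑ j, cvInt ξ v j ^ 2 := by
  have hex (ξ : Fin (k + 2) → ℝ) : ∃ C, 0 ≤ C ∧ ∀ A, RefAdmissible ξ A → ∀ v : ℝ[X],
      v.degree < (k + 1 : ℕ) → (∀ j, v.eval (ξ j) ^ 2 ≤ C * cellInner ξ A v v) ∧
      cellInner ξ A v v ≤ C * ∑ j, cvInt ξ v j ^ 2 := by
    by_cases hA : ∃ A, RefAdmissible ξ A
    · obtain ⟨A, hA⟩ := hA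
      obtain ⟨C, hC, h⟩ := hA.exists_bounds
      refine ⟨C, hC, fun A' hA' v hv => ?_⟩
      rw [← hA.cellInner_congr hA' v hv]
      exact h v hv
    · exact ⟨0, le_rfl, fun A h => (hA ⟨A, h⟩).elim⟩
  choose C hC h using hex
  refine ⟨∑ ξ ∈ P, C ξ, Finset.sum_nonneg fun ξ _ => hC ξ, fun ξ hξ A hA v hv => ?_⟩
  have hle : C ξ ≤ ∑ ξ ∈ P, C ξ := Finset.single_le_sum (fun ξ _ => hC ξ) hξ
  have hq : 0 ≤ cellInner ξ A v v := by
    by_cases hv0 : v = 0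
    · simp [hv0, cellInner, cvInt]
    · exact (hA.cellInner_pos hv hv0).le
  refine ⟨hq, fun j => ((h ξ A hA v hv).1 j).trans (mul_le_mul_of_nonneg_right hle hq),
    ((h ξ A hA v hv).2).trans (mul_le_mul_of_nonneg_right hle
      (Finset.sum_nonneg fun _ _ => sq_nonneg _))⟩

/-! ### Affine scaling to the reference cell -/

section Scaling

variable {x : Fin (k + 2) → ℝ} {e h : ℝ}

/-- The pullback of a polynomial under `t ↦ e + h t`. -/
noncomputable def pull (e h : ℝ) (v : ℝ[X]) : ℝ[X] := v.comp (C h * X + C e)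

theorem eval_pull (v : ℝ[X]) (t : ℝ) : (pull e h v).eval t = v.eval (e + h * t) := by
  rw [pull, eval_comp]
  congr 1
  simp
  ring

theorem degree_comp_linear_lt {p : ℝ[X]} {c d : ℝ} {n : ℕ} (hp : p.degree < (n : WithBot ℕ)) :
    (p.comp (C c * X + C d)).degree < (n : WithBot ℕ) := by
  by_cases h0 : p.comp (C c * X + C d) = 0
  · rw [h0, degree_zero]; exact WithBot.bot_lt_coe _
  have hp0 : p ≠ 0 := by rintro rfl; simp at h0
  rw [← natDegree_lt_iff_degree_lt h0]
  rw [← natDegree_lt_iff_degree_lt hp0] at hp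
  refine lt_of_le_of_lt (natDegree_comp_le.trans ?_) hp
  calc _ ≤ p.natDegree * 1 := Nat.mul_le_mul_left _ natDegree_linear_le
    _ = _ := mul_one _

theorem integral_eval_pull (v : ℝ[X]) (c d : ℝ) :
    ∫ t in e + h * c..e + h * d, v.eval t = h * ∫ t in c..d, (pull e h v).eval t := by
  simp only [eval_pull]
  exact (intervalIntegral.mul_integral_comp_add_mul (f := fun t => v.eval t) h e).symm

theorem cvInt_scale (hx : ∀ j, x j = e + h * ξ j) (v : ℝ[X]) (j : Fin (k + 1)) :
    cvInt x v j = h * cvInt ξ (pull e h v) j := by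
  rw [cvInt, hx, hx, integral_eval_pull, cvInt]

/-- The chain rule gives the derivative a factor `h`, absorbed by dividing the weights by `h`. -/
theorem testValue_scale (hx : ∀ j, x j = e + h * ξ j) (hh : h ≠ 0) (v : ℝ[X])
    (j : Fin (k + 1)) :
    testValue x A v j = testValue ξ (fun l => A l / h) (pull e h v) j := by
  have hd : (pull e h v).derivative = C h * pull e h v.derivative := by
    rw [pull, derivative_comp, pull]
    simp
  simp only [testValue, hd, eval_mul, eval_C, eval_pull, hx]
  congr 1
  refine Finset.sum_congr rfl fun l _ => ?_
  field_simp

theorem cellInner_scale (hx : ∀ j, x j = e + h * ξ j) (hh : h ≠ 0) (v w : ℝ[X]) :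
    cellInner x A v w = h * cellInner ξ (fun l => A l / h) (pull e h v) (pull e h w) := by
  simp only [cellInner, cvInt_scale hx, testValue_scale hx hh, Finset.mul_sum, mul_assoc]

end Scaling

end Cell

/-! ### Bilinear-form version, Cauchy–Schwarz and reconstruction -/

/-- Energy growth of one Runge-Kutta step, for a positive definite bilinear form. -/
theorem RKMethod.exists_form_step_le (rk : RKMethod) (hrk : rk.slope rk.s = 1) (K T : ℝ)
    (hK : 0 ≤ K) :
    ∃ C, 0 ≤ C ∧ ∃ C', 0 ≤ C' ∧
      ∀ (V : Type) [AddCommGroup V] [Module ℝ V] (B : V →ₗ[ℝ] V →ₗ[ℝ] ℝ),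
      (∀ v w, B v w = B w v) → (∀ v, v ≠ 0 → 0 < B v v) →
      ∀ (L : V →ₗ[ℝ] V) (τ : ℝ) (U G : ℕ → V), 0 < τ → τ ≤ T → (∀ v, B (L v) v ≤ 0) →
      (∀ v, τ ^ 2 * B (L v) (L v) ≤ K * τ * B v v) →
      (∀ l < rk.s, U (l + 1) = ∑ κ ∈ Finset.range (l + 1),
        (rk.c l κ • U κ + (τ * rk.d l κ) • (L (U κ) + G κ))) →
      B (U rk.s) (U rk.s) ≤ (1 + C * τ) * B (U 0) (U 0) +
        C' * τ * ∑ κ ∈ Finset.range rk.s, B (G κ) (G κ) := by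
  obtain ⟨C, hC, C', hC', h⟩ := rk.exists_norm_sq_step_le hrk K T hK
  refine ⟨C, hC, C', hC', fun V _ _ B hsymm hpos L τ U G hτ hT hdiss hL hU => ?_⟩
  let core := coreOfPosDef B hsymm hpos
  let : NormedAddCommGroup V := core.toNormedAddCommGroup
  let : InnerProductSpace ℝ V := InnerProductSpace.ofCore core.toCore
  have hnorm (v : V) : ‖v‖ ^ 2 = B v v := (real_inner_self_eq_norm_sq v).symm
  have := h V L τ U G hτ hT hdiss (fun v => by
    rw [norm_smul, mul_pow, hnorm, hnorm, Real.norm_eq_abs, sq_abs]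
    exact hL v) hU
  simpa only [hnorm] using this

/-- Nonnegativity of the variance around the mean `m`. -/
theorem sq_integral_le {c d : ℝ} (hcd : c < d) {f : ℝ → ℝ}
    (hf : IntervalIntegrable f MeasureTheory.volume c d)
    (hf2 : IntervalIntegrable (fun t => f t ^ 2) MeasureTheory.volume c d) :
    (∫ t in c..d, f t) ^ 2 ≤ (d - c) * ∫ t in c..d, f t ^ 2 := by
  have hdc : 0 < d - c := sub_pos.2 hcd
  set I := ∫ t in c..d, f t
  set m := I / (d - c) with hm
  have h0 : 0 ≤ ∫ t in c..d, (f t - m) ^ 2 :=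
    intervalIntegral.integral_nonneg hcd.le fun _ _ => sq_nonneg _
  have h1 : ∫ t in c..d, (f t - m) ^ 2 = (∫ t in c..d, f t ^ 2) - 2 * m * I + m ^ 2 * (d - c) := by
    have : (fun t => (f t - m) ^ 2) = fun t => f t ^ 2 - 2 * m * f t + m ^ 2 := by
      funext t; ring
    rw [this, intervalIntegral.integral_add (hf2.sub (hf.const_mul _)) (by simp),
      intervalIntegral.integral_sub hf2 (hf.const_mul _), intervalIntegral.integral_const_mul,
      intervalIntegral.integral_const, smul_eq_mul]
    ring
  have hI : I = m * (d - c) := by rw [hm]; field_simp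
  rw [h1] at h0
  have h2 := mul_nonneg hdc.le h0
  rw [hI] at h2 ⊢
  linarith

/-- A polynomial of degree at most `k` is determined by its integrals over `k + 1` control
volumes. -/
noncomputable def cvEquiv {k : ℕ} (x : Fin (k + 2) → ℝ) (hx : StrictMono x) :
    degreeLT ℝ (k + 1) ≃ₗ[ℝ] (Fin (k + 1) → ℝ) :=
  LinearMap.linearEquivOfInjective (LinearMap.pi (cvIntLin x))
    (by
      rw [← LinearMap.ker_eq_bot, LinearMap.ker_eq_bot']
      exact fun v hv => Subtype.ext
        (eq_zero_of_cvInt_eq_zero hx (mem_degreeLT.1 v.2) fun j => congrFun hv j))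
    (degreeLTEquiv ℝ (k + 1)).finrank_eq

/-! ### Mesh sizes and cell bounds on the physical mesh -/

namespace SVMesh

variable {a b : ℝ} {k N : ℕ} (M : SVMesh a b k N)

theorem cellSize_pos (i : Fin N) : 0 < M.cellSize i := by
  rw [cellSize, ← M.x_first, ← M.x_last, sub_pos]
  exact M.x_strictMono i (Fin.last_pos)

theorem e_monotone : Monotone M.e := by
  rw [Fin.monotone_iff_le_succ]
  exact fun i => (sub_pos.1 (M.cellSize_pos i)).le

theorem cellSize_le (i : Fin N) : M.cellSize i ≤ b - a := by
  have h1 := M.e_monotone (Fin.zero_le i.castSucc)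
  have h2 := M.e_monotone (Fin.le_last i.succ)
  rw [M.e_first] at h1
  rw [M.e_last] at h2
  rw [cellSize]
  linarith

theorem cellSize_le_meshSize [NeZero N] (i : Fin N) : M.cellSize i ≤ M.meshSize :=
  Finset.le_sup' M.cellSize (Finset.mem_univ i)

theorem meshSize_pos [NeZero N] : 0 < M.meshSize :=
  (M.cellSize_pos 0).trans_le (M.cellSize_le_meshSize 0)

theorem meshSize_le [NeZero N] : M.meshSize ≤ b - a :=
  Finset.sup'_le _ _ fun i _ => M.cellSize_le i

variable {M} {A : Fin N → Fin (k + 2) → ℝ}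

theorem Admissible.exactQuad (hA : M.Admissible A) (i : Fin N) : ExactQuad (M.x i) (A i) := by
  intro p hp
  rw [M.x_first, M.x_last]
  exact hA.exact_quad i p hp

theorem Admissible.refAdmissible (hA : M.Admissible A) (hU : Upwind A) {i : Fin N}
    {ξ : Fin (k + 2) → ℝ} (hξ : ∀ j, M.x i j = M.e i.castSucc + M.cellSize i * ξ j) :
    RefAdmissible ξ (fun l => A i l / M.cellSize i) := by
  have hh := M.cellSize_pos i
  set h := M.cellSize i with hhdef
  set e := M.e i.castSucc with he
  have hmono : StrictMono ξ := fun j l hjl => by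
    have := M.x_strictMono i hjl
    rw [hξ, hξ] at this
    exact lt_of_mul_lt_mul_left (by linarith) hh.le
  have h0 : ξ 0 = 0 := by
    have := hξ 0
    rw [M.x_first] at this
    exact (mul_eq_zero.1 (by linarith : h * ξ 0 = 0)).resolve_left hh.ne'
  have h1 : ξ (Fin.last _) = 1 := by
    have := hξ (Fin.last _)
    rw [M.x_last] at this
    have h2 : h = M.e i.succ - e := rfl
    have : h * (ξ (Fin.last _) - 1) = 0 := by rw [mul_sub]; linarith
    linarith [(mul_eq_zero.1 this).resolve_left hh.ne']
  set q : ℝ[X] := C h⁻¹ * (X - C e) with hq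
  have hev (p : ℝ[X]) (t : ℝ) : (p.comp q).eval (e + h * t) = p.eval t := by
    rw [eval_comp, hq]
    congr 1
    simp only [eval_mul, eval_C, eval_sub, eval_X]
    field_simp
    ring
  refine ⟨hmono, h0, h1, fun p hp => ?_, fun hk => ?_, by rw [hU i, zero_div]⟩
  · have hdeg : (p.comp q).degree < ((2 * k : ℕ) : WithBot ℕ) := by
      have : q = C h⁻¹ * X + C (-(h⁻¹ * e)) := by
        rw [hq]; simp only [map_neg, map_mul]; ring
      rw [this]
      exact degree_comp_linear_lt hp
    have h2 := hA.exactQuad i _ hdeg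
    rw [hξ, hξ, integral_eval_pull] at h2
    simp only [eval_pull, hξ] at h2
    simp only [hev] at h2
    rw [← mul_right_inj' hh.ne', h2, Finset.mul_sum]
    refine Finset.sum_congr rfl fun j _ => ?_
    field_simp
  · have h2 := hA.pos hk i
    -- The degrees have equal parity, so the two sign conventions for the Legendre polynomials agree
    -- on the product.
    have hsgn : (-1 : ℝ) ^ (k + 1) * (-1) ^ (k - 1) = 1 := by
      rw [← pow_add, show k + 1 + (k - 1) = 2 * k by omega, pow_mul]; simp
    have h3 : M.quad A i (M.legendre i (k + 1) * M.legendre i (k - 1)) =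
        h * ∑ j, A i j / h * (legendreP (k + 1) * legendreP (k - 1)).eval (ξ j) := by
      rw [quad, Finset.mul_sum]
      refine Finset.sum_congr rfl fun j _ => ?_
      have hl (l : ℕ) : (M.legendre i l).eval (M.x i j) = (-1) ^ l * (legendreP l).eval (ξ j) := by
        rw [legendre, eval_mul, hξ]
        change _ * ((legendreP l).comp q).eval (e + h * ξ j) = _
        rw [hev]
        simp
      rw [eval_mul, hl, hl, eval_mul]
      field_simp
      linear_combination
        (A i j * (legendreP (k + 1)).eval (ξ j) * (legendreP (k - 1)).eval (ξ j)) * hsgn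
    rw [h3, ← hhdef, div_eq_mul_one_div, ← mul_sub] at h2
    exact (pos_iff_pos_of_mul_pos h2).1 hh

/-- The energy form scales like `h_i` and squared control-volume integrals like `h_i²`, which puts
`1 / h_i` in both bounds. -/
theorem exists_cell_bounds (k : ℕ) (P : Finset (Fin (k + 2) → ℝ)) :
    ∃ C, 0 ≤ C ∧ ∀ {a b : ℝ} {N : ℕ} (M : SVMesh a b k N) (A : Fin N → Fin (k + 2) → ℝ),
      M.SubdividedBy P → M.Admissible A → Upwind A → ∀ (i : Fin N) (v : ℝ[X]),
      v.degree < (k + 1 : ℕ) →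
      0 ≤ cellInner (M.x i) (A i) v v ∧
      (v ≠ 0 → 0 < cellInner (M.x i) (A i) v v) ∧
      (∀ j, v.eval (M.x i j) ^ 2 ≤ C / M.cellSize i * cellInner (M.x i) (A i) v v) ∧
      cellInner (M.x i) (A i) v v ≤ C / M.cellSize i * ∑ j, cvInt (M.x i) v j ^ 2 := by
  obtain ⟨C, hC, h⟩ := exists_uniform_bounds P
  refine ⟨C, hC, fun M A hP hA hU i v hv => ?_⟩
  obtain ⟨ξ, hξP, hξ⟩ := hP i
  have hh := M.cellSize_pos i
  have hR := hA.refAdmissible hU hξ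
  have hpv : (pull (M.e i.castSucc) (M.cellSize i) v).degree < (k + 1 : ℕ) :=
    degree_comp_linear_lt hv
  obtain ⟨b0, b1, b2⟩ := h ξ hξP _ hR _ hpv
  rw [cellInner_scale hξ hh.ne']
  refine ⟨by positivity, fun hv0 => mul_pos hh (hR.cellInner_pos hpv fun h0 => hv0 ?_),
    fun j => ?_, ?_⟩
  · refine eq_zero_of_cvInt_eq_zero (M.x_strictMono i) hv fun j => ?_
    rw [cvInt_scale hξ, h0]
    simp [cvInt]
  · have := b1 j
    rw [eval_pull, ← hξ] at this
    refine this.trans (le_of_eq ?_)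
    field_simp
  · simp only [cvInt_scale hξ, mul_pow, ← Finset.mul_sum]
    refine (mul_le_mul_of_nonneg_left b2 hh.le).trans (le_of_eq ?_)
    field_simp

/-! ### The global energy form and the spatial operator -/

variable (M)

/-- The energy inner product as a bilinear form. -/
noncomputable def starForm (A : Fin N → Fin (k + 2) → ℝ) :
    DGSpace k N →ₗ[ℝ] DGSpace k N →ₗ[ℝ] ℝ :=
  LinearMap.mk₂ ℝ (fun v w => ∑ i, cellForm (M.x i) (A i) (v i) (w i))
    (fun _ _ _ => by
      simp only [Pi.add_apply, map_add, LinearMap.add_apply, Finset.sum_add_distrib])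
    (fun _ _ _ => by
      simp only [Pi.smul_apply, map_smul, LinearMap.smul_apply, Finset.smul_sum])
    (fun _ _ _ => by simp only [Pi.add_apply, map_add, Finset.sum_add_distrib])
    (fun _ _ _ => by simp only [Pi.smul_apply, map_smul, Finset.smul_sum])

theorem starForm_apply (v w : DGSpace k N) :
    M.starForm A v w = ∑ i, cellInner (M.x i) (A i) (v i) (w i) := rfl

/-- Reconstruction of a function from its integrals over the control volumes. -/
noncomputable def ofCvIntegral : (Fin N → Fin (k + 1) → ℝ) →ₗ[ℝ] DGSpace k N :=
  (LinearEquiv.piCongrRight fun i => cvEquiv (M.x i) (M.x_strictMono i)).symm.toLinearMap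

theorem cvInt_ofCvIntegral (f : Fin N → Fin (k + 1) → ℝ) (i : Fin N) (j : Fin (k + 1)) :
    cvInt (M.x i) (M.ofCvIntegral f i) j = f i j :=
  congrFun ((cvEquiv (M.x i) (M.x_strictMono i)).apply_symm_apply (f i)) j

theorem eq_of_cvInt_eq {v w : DGSpace k N}
    (h : ∀ i j, cvInt (M.x i) (v i) j = cvInt (M.x i) (w i) j) : v = w :=
  funext fun i => (cvEquiv (M.x i) (M.x_strictMono i)).injective (funext fun j => h i j)

section Upwind

variable [NeZero N]

/-- The differences of the upwind fluxes as a linear map. -/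
noncomputable def fluxDiff (β : ℝ) : DGSpace k N →ₗ[ℝ] (Fin N → Fin (k + 1) → ℝ) where
  toFun v i j := β * (M.upwindValue v i j.castSucc - M.upwindValue v i j.succ)
  map_add' v w := by
    funext i j
    simp only [upwindValue, Pi.add_apply, Submodule.coe_add, eval_add]
    split_ifs <;> ring
  map_smul' r v := by
    funext i j
    simp only [upwindValue, Pi.smul_apply, Submodule.coe_smul, eval_smul, smul_eq_mul,
      RingHom.id_apply]
    split_ifs <;> ring

/-- The spatial operator of the scheme. -/
noncomputable def svOperator (β : ℝ) : DGSpace k N →ₗ[ℝ] DGSpace k N :=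
  M.ofCvIntegral ∘ₗ M.fluxDiff β

theorem cvInt_svOperator (β : ℝ) (v : DGSpace k N) (i : Fin N) (j : Fin (k + 1)) :
    cvInt (M.x i) (M.svOperator β v i) j =
      β * (M.upwindValue v i j.castSucc - M.upwindValue v i j.succ) :=
  M.cvInt_ofCvIntegral _ _ _

theorem sum_sub_one (f : Fin N → ℝ) : ∑ i, f (i - 1) = ∑ i, f i :=
  Equiv.sum_comp (Equiv.subRight (1 : Fin N)) f

variable {M}

/-- By Young's inequality each cell contributes at most half the square of its inflow trace minus
half the square of its outflow trace. These cancel around the periodic mesh. -/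
theorem starForm_svOperator_nonpos (hA : M.Admissible A) (hU : Upwind A) {β : ℝ} (hβ : 0 < β)
    (v : DGSpace k N) : M.starForm A (M.svOperator β v) v ≤ 0 := by
  have hcell (i : Fin N) : cellInner (M.x i) (A i) (M.svOperator β v i) (v i) =
      β * ((v (i - 1) : ℝ[X]).eval (M.x (i - 1) (Fin.last _)) * (v i : ℝ[X]).eval (M.x i 0) -
        ((v i : ℝ[X]).eval (M.x i (Fin.last _)) ^ 2 + (v i : ℝ[X]).eval (M.x i 0) ^ 2) / 2) := by
    rw [cellInner, ← sum_flux_mul_testValue (hA.exactQuad i) (hU i) (mem_degreeLT.1 (v i).2) _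
      (U := M.upwindValue v i) (by simp [upwindValue]) (fun j hj => by simp [upwindValue, hj]),
      Finset.mul_sum]
    exact Finset.sum_congr rfl fun j _ => by rw [cvInt_svOperator]; ring
  rw [starForm_apply, Finset.sum_congr rfl fun i _ => hcell i, ← Finset.mul_sum]
  refine mul_nonpos_of_nonneg_of_nonpos hβ.le ?_
  have hshift := sum_sub_one fun i => (v i : ℝ[X]).eval (M.x i (Fin.last _)) ^ 2 / 2
  have hle : ∑ i, ((v (i - 1) : ℝ[X]).eval (M.x (i - 1) (Fin.last _)) *
      (v i : ℝ[X]).eval (M.x i 0) -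
        ((v i : ℝ[X]).eval (M.x i (Fin.last _)) ^ 2 + (v i : ℝ[X]).eval (M.x i 0) ^ 2) / 2) ≤
      ∑ i, ((v (i - 1) : ℝ[X]).eval (M.x (i - 1) (Fin.last _)) ^ 2 / 2 -
        (v i : ℝ[X]).eval (M.x i (Fin.last _)) ^ 2 / 2) :=
    Finset.sum_le_sum fun i _ => by
      nlinarith [sq_nonneg ((v (i - 1) : ℝ[X]).eval (M.x (i - 1) (Fin.last _)) -
        (v i : ℝ[X]).eval (M.x i 0))]
  refine hle.trans (le_of_eq ?_)
  rw [Finset.sum_sub_distrib, hshift, sub_self]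

/-- The inverse estimate for the spatial operator. -/
theorem starForm_svOperator_le {C ρ : ℝ} (hC : 0 ≤ C) (hρ : M.QuasiUniform ρ)
    (hb : ∀ (i : Fin N) (v : ℝ[X]), v.degree < (k + 1 : ℕ) →
      0 ≤ cellInner (M.x i) (A i) v v ∧
      (∀ j, v.eval (M.x i j) ^ 2 ≤ C / M.cellSize i * cellInner (M.x i) (A i) v v) ∧
      cellInner (M.x i) (A i) v v ≤ C / M.cellSize i * ∑ j, cvInt (M.x i) v j ^ 2)
    (β : ℝ) (v : DGSpace k N) :
    M.starForm A (M.svOperator β v) (M.svOperator β v) ≤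
      8 * (k + 1) * (C * ρ * β) ^ 2 / M.meshSize ^ 2 * M.starForm A v v := by
  have hh := M.meshSize_pos
  set h := M.meshSize with hhdef
  have hρ0 : 0 ≤ ρ := by
    have := hh.trans_le (hρ 0)
    exact ((pos_iff_pos_of_mul_pos this).2 (M.cellSize_pos 0)).le
  have hdiv (i : Fin N) : C / M.cellSize i ≤ C * ρ / h := by
    rw [div_le_div_iff₀ (M.cellSize_pos i) hh, mul_assoc]
    exact mul_le_mul_of_nonneg_left (hρ i) hC
  -- `D` enters twice, bounding point values by energy and energy by control-volume integrals; hence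
  -- the factor `h⁻²`.
  set D := C * ρ / h with hD
  have hD0 : 0 ≤ D := by positivity
  set q : Fin N → ℝ := fun i => cellInner (M.x i) (A i) (v i) (v i) with hq
  have hq0 (i : Fin N) : 0 ≤ q i := (hb i _ (mem_degreeLT.1 (v i).2)).1
  have hev (i : Fin N) (j : Fin (k + 2)) : (v i : ℝ[X]).eval (M.x i j) ^ 2 ≤ D * q i :=
    ((hb i _ (mem_degreeLT.1 (v i).2)).2.1 j).trans (mul_le_mul_of_nonneg_right (hdiv i) (hq0 i))
  have hup (i : Fin N) (j : Fin (k + 2)) :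
      M.upwindValue v i j ^ 2 ≤ D * (q i + q (i - 1)) := by
    have p1 := mul_nonneg hD0 (hq0 i)
    have p2 := mul_nonneg hD0 (hq0 (i - 1))
    rw [mul_add]
    rw [upwindValue]
    split_ifs
    · linarith [hev (i - 1) (Fin.last _)]
    · linarith [hev i j]
  -- The `4` comes from squaring a difference of two values, each bounded through two neighbouring
  -- cells, and `k + 1` counts control volumes. Summing `q i + q (i - 1)` doubles this to the final
  -- `8`.
  have hcell (i : Fin N) :
      cellInner (M.x i) (A i) (M.svOperator β v i) (M.svOperator β v i) ≤
        4 * (k + 1) * (D * β) ^ 2 * (q i + q (i - 1)) := by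
    refine ((hb i _ (mem_degreeLT.1 (M.svOperator β v i).2)).2.2).trans ?_
    refine (mul_le_mul_of_nonneg_right (hdiv i)
      (Finset.sum_nonneg fun _ _ => sq_nonneg _)).trans ?_
    have hsum : ∑ j, cvInt (M.x i) (M.svOperator β v i) j ^ 2 ≤
        ∑ _j : Fin (k + 1), 4 * β ^ 2 * (D * (q i + q (i - 1))) := by
      refine Finset.sum_le_sum fun j _ => ?_
      rw [cvInt_svOperator, mul_pow]
      have e : (M.upwindValue v i j.castSucc - M.upwindValue v i j.succ) ^ 2 ≤
          4 * (D * (q i + q (i - 1))) := by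
        nlinarith [hup i j.castSucc, hup i j.succ,
          sq_nonneg (M.upwindValue v i j.castSucc + M.upwindValue v i j.succ)]
      have := mul_le_mul_of_nonneg_left e (sq_nonneg β)
      linarith
    rw [Finset.sum_const, Finset.card_univ, Fintype.card_fin, nsmul_eq_mul] at hsum
    refine (mul_le_mul_of_nonneg_left hsum hD0).trans (le_of_eq ?_)
    push_cast
    ring
  rw [starForm_apply]
  refine (Finset.sum_le_sum fun i _ => hcell i).trans (le_of_eq ?_)
  rw [← Finset.mul_sum, Finset.sum_add_distrib, sum_sub_one q, starForm_apply, hD]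
  field_simp
  ring

end Upwind

/-! ### Source terms, definiteness and the operator form of the stages -/

theorem x_mem_Icc (i : Fin N) (j : Fin (k + 2)) : M.x i j ∈ Set.Icc a b := by
  have h1 := (M.x_strictMono i).monotone (Fin.zero_le j)
  have h2 := (M.x_strictMono i).monotone (Fin.le_last j)
  have h3 := M.e_monotone (Fin.zero_le i.castSucc)
  have h4 := M.e_monotone (Fin.le_last i.succ)
  rw [M.x_first] at h1
  rw [M.x_last] at h2
  rw [M.e_first] at h3
  rw [M.e_last] at h4
  exact ⟨h3.trans h1, h2.trans h4⟩

theorem sum_sum_integral {f : ℝ → ℝ}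
    (hf : MeasureTheory.IntegrableOn f (Set.Icc a b)) :
    ∑ i, ∑ j : Fin (k + 1), ∫ t in M.x i j.castSucc..M.x i j.succ, f t = ∫ t in a..b, f t := by
  have hle : a ≤ b := by
    have := M.e_monotone (Fin.zero_le (Fin.last N))
    rwa [M.e_first, M.e_last] at this
  have hint {c d : ℝ} (hc : c ∈ Set.Icc a b) (hd : d ∈ Set.Icc a b) :
      IntervalIntegrable f MeasureTheory.volume c d :=
    (hf.mono_set (Set.uIcc_subset_Icc hc hd)).intervalIntegrable
  set F : ℝ → ℝ := fun t => ∫ s in a..t, f s with hF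
  have ha : a ∈ Set.Icc a b := ⟨le_rfl, hle⟩
  have hsub (i : Fin N) (j : Fin (k + 1)) : ∫ t in M.x i j.castSucc..M.x i j.succ, f t =
      F (M.x i j.succ) - F (M.x i j.castSucc) :=
    (intervalIntegral.integral_interval_sub_left (hint ha (M.x_mem_Icc _ _))
      (hint ha (M.x_mem_Icc _ _))).symm
  simp only [hsub]
  have hcell (i : Fin N) : ∑ j : Fin (k + 1), (F (M.x i j.succ) - F (M.x i j.castSucc)) =
      F (M.e i.succ) - F (M.e i.castSucc) := by
    rw [sum_succ_sub_castSucc (fun j => F (M.x i j)), M.x_last, M.x_first]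
  simp only [hcell]
  rw [sum_succ_sub_castSucc (fun i => F (M.e i)), M.e_last, M.e_first]
  simp [hF]

variable {M}

/-- Cauchy–Schwarz on a control volume yields a factor at most `h_i`, which cancels the `1 / h_i` of
the norm equivalence, so the bound is independent of the mesh. -/
theorem starForm_source_le {C : ℝ} (hC : 0 ≤ C)
    (hb : ∀ (i : Fin N) (v : ℝ[X]), v.degree < (k + 1 : ℕ) →
      cellInner (M.x i) (A i) v v ≤ C / M.cellSize i * ∑ j, cvInt (M.x i) v j ^ 2)
    {f : ℝ → ℝ} (hf : MeasureTheory.MemLp f 2 (MeasureTheory.volume.restrict (Set.Icc a b)))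
    (G : DGSpace k N)
    (hG : ∀ i j, cvInt (M.x i) (G i) j = ∫ t in M.x i j.castSucc..M.x i j.succ, f t) :
    M.starForm A G G ≤ C * ∫ t in a..b, f t ^ 2 := by
  have hf1 : MeasureTheory.IntegrableOn f (Set.Icc a b) := hf.integrable one_le_two
  have hf2 : MeasureTheory.IntegrableOn (fun t => f t ^ 2) (Set.Icc a b) := hf.integrable_sq
  rw [← M.sum_sum_integral hf2, starForm_apply, Finset.mul_sum]
  refine Finset.sum_le_sum fun i _ => (hb i _ (mem_degreeLT.1 (G i).2)).trans ?_
  have hh := M.cellSize_pos i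
  have hsum : ∑ j, cvInt (M.x i) (G i) j ^ 2 ≤
      M.cellSize i * ∑ j : Fin (k + 1), ∫ t in M.x i j.castSucc..M.x i j.succ, f t ^ 2 := by
    rw [Finset.mul_sum]
    refine Finset.sum_le_sum fun j _ => ?_
    have hlt : M.x i j.castSucc < M.x i j.succ := M.x_strictMono i Fin.castSucc_lt_succ
    have hss : Set.uIcc (M.x i j.castSucc) (M.x i j.succ) ⊆ Set.Icc a b :=
      Set.uIcc_subset_Icc (M.x_mem_Icc _ _) (M.x_mem_Icc _ _)
    rw [hG]
    refine (sq_integral_le hlt (hf1.mono_set hss).intervalIntegrable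
      (hf2.mono_set hss).intervalIntegrable).trans (mul_le_mul_of_nonneg_right ?_
        (intervalIntegral.integral_nonneg hlt.le fun _ _ => sq_nonneg _))
    have h1 := (M.x_strictMono i).monotone (Fin.zero_le j.castSucc)
    have h2 := (M.x_strictMono i).monotone (Fin.le_last j.succ)
    rw [M.x_first] at h1
    rw [M.x_last] at h2
    rw [cellSize]
    linarith
  refine (mul_le_mul_of_nonneg_left hsum (by positivity)).trans (le_of_eq ?_)
  field_simp

theorem starForm_symm (hA : M.Admissible A) (v w : DGSpace k N) :
    M.starForm A v w = M.starForm A w v := by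
  rw [starForm_apply, starForm_apply]
  exact Finset.sum_congr rfl fun i _ =>
    cellInner_comm (hA.exactQuad i) (mem_degreeLT.1 (v i).2) (mem_degreeLT.1 (w i).2)

theorem starForm_pos
    (hb : ∀ (i : Fin N) (v : ℝ[X]), v.degree < (k + 1 : ℕ) →
      0 ≤ cellInner (M.x i) (A i) v v ∧ (v ≠ 0 → 0 < cellInner (M.x i) (A i) v v))
    (v : DGSpace k N) (hv : v ≠ 0) : 0 < M.starForm A v v := by
  obtain ⟨i, hi⟩ := Function.ne_iff.1 hv
  rw [starForm_apply]
  refine Finset.sum_pos' (fun i _ => (hb i _ (mem_degreeLT.1 (v i).2)).1)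
    ⟨i, Finset.mem_univ _, (hb i _ (mem_degreeLT.1 (v i).2)).2 fun h0 => hi (Subtype.ext h0)⟩

/-- The stages of the scheme in operator form. -/
theorem IsSolution.stage_eq [NeZero N] {rk : RKMethod} {β τ : ℝ} {steps : ℕ}
    {g : ℕ → ℕ → ℝ → ℝ} {u : ℕ → DGSpace k N} {U : ℕ → ℕ → DGSpace k N}
    (h : M.IsSolution rk β τ steps g u U) {n : ℕ} (hn : n < steps) {l : ℕ} (hl : l < rk.s) :
    U n (l + 1) = ∑ κ ∈ Finset.range (l + 1), (rk.c l κ • U n κ + (τ * rk.d l κ) •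
      (M.svOperator β (U n κ) +
        M.ofCvIntegral fun i j => ∫ t in M.x i j.castSucc..M.x i j.succ, g n κ t)) := by
  -- Both sides lie in the trial space, where control-volume integrals determine a function;
  -- compared there, the identity is the balance law.
  refine M.eq_of_cvInt_eq fun i j => ?_
  refine (h.stages n hn l hl i j).trans ?_
  change _ = cvIntLin (M.x i) j ((∑ κ ∈ Finset.range (l + 1), _ : DGSpace k N) i)
  rw [Finset.sum_apply, map_sum]
  refine Finset.sum_congr rfl fun κ _ => ?_
  simp only [Pi.add_apply, Pi.smul_apply, map_add, map_smul, smul_eq_mul]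
  congr 3
  · exact (M.cvInt_svOperator β (U n κ) i j).symm
  · exact (M.cvInt_ofCvIntegral
      (fun i j => ∫ t in M.x i j.castSucc..M.x i j.succ, g n κ t) i j).symm

end SVMesh

end RKSV

/-! ### Conclusion -/

theorem mainTheorem2 (rk : RKSV.RKMethod) (r : ℕ) (hr : 1 ≤ r) (hrk : rk.HasOrder r) :
    ∃ γ : ℝ, 1 ≤ γ ∧
      ∀ (a b : ℝ) (_ : a < b) (β : ℝ) (_ : 0 < β) (k : ℕ) (ρ : ℝ)
        (P : Finset (Fin (k + 2) → ℝ)),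
        ∃ C_CFL : ℝ, 0 < C_CFL ∧ ∃ Cs : ℝ, 0 ≤ Cs ∧ ∃ Cs' : ℝ, 0 ≤ Cs' ∧
          ∀ (N : ℕ) [NeZero N] (M : RKSV.SVMesh a b k N),
            M.QuasiUniform ρ → M.SubdividedBy P →
            ∀ A : Fin N → Fin (k + 2) → ℝ,
              M.Admissible A → RKSV.SVMesh.Upwind A →
              ∀ τ : ℝ, 0 < τ → τ / M.meshSize ^ γ ≤ C_CFL →
              ∀ (steps : ℕ) (g : ℕ → ℕ → ℝ → ℝ),
                (∀ n < steps, ∀ ℓ < rk.s,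
                  MeasureTheory.MemLp (g n ℓ) 2
                    (MeasureTheory.volume.restrict (Set.Icc a b))) →
                ∀ (u : ℕ → RKSV.DGSpace k N) (U : ℕ → ℕ → RKSV.DGSpace k N),
                  M.IsSolution rk β τ steps g u U →
                  ∀ n < steps,
                    M.starNorm A (u (n + 1)) ^ 2 ≤
                      (1 + Cs * τ) * M.starNorm A (u n) ^ 2 +
                        Cs' * τ * ∑ ℓ ∈ Finset.range rk.s, ∫ t in a..b, g n ℓ t ^ 2 := by
  -- The exponent `2` works for every method: the inverse estimate gives `‖τL‖² ≤ K (τ/h)²`, and `τ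
  -- ≤ h²` makes this at most `Kτ`.
  refine ⟨2, one_le_two, fun a b _ β hβ k ρ P => ?_⟩
  obtain ⟨C, hC, hb⟩ := RKSV.SVMesh.exists_cell_bounds k P
  -- `K` is the inverse-estimate constant without `h⁻²`. The cap on `τ` is `(b - a)²`, since `τ ≤
  -- h²` and `h ≤ b - a`.
  obtain ⟨C₁, hC₁, C₂, hC₂, hstep⟩ := rk.exists_form_step_le (hrk.slope_eq_one hr)
    (8 * (k + 1) * (C * ρ * β) ^ 2) ((b - a) ^ 2) (by positivity)
  refine ⟨1, one_pos, C₁, hC₁, C₂ * C, by positivity, fun N _ M hρ hP A hA hU τ hτ hCFL steps g hg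
    u U hsol n hn => ?_⟩
  have hb' := hb M A hP hA hU
  have hh := M.meshSize_pos
  have hτh : τ ≤ M.meshSize ^ 2 := by
    rw [Real.rpow_two, div_le_one (by positivity)] at hCFL
    exact hCFL
  have hpos := RKSV.SVMesh.starForm_pos (A := A) fun i v hv => ⟨(hb' i v hv).1, (hb' i v hv).2.1⟩
  have hnonneg (v : RKSV.DGSpace k N) : 0 ≤ M.starForm A v v := by
    by_cases hv : v = 0
    · simp [hv]
    · exact (hpos v hv).le
  have hnorm (v : RKSV.DGSpace k N) : M.starNorm A v ^ 2 = M.starForm A v v :=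
    Real.sq_sqrt (hnonneg v)
  have key := hstep (RKSV.DGSpace k N) (M.starForm A) (RKSV.SVMesh.starForm_symm hA) hpos (M.svOperator β) τ (U n)
    (fun κ => M.ofCvIntegral fun i j => ∫ t in M.x i j.castSucc..M.x i j.succ, g n κ t) hτ
    (hτh.trans (pow_le_pow_left₀ hh.le M.meshSize_le 2)) (RKSV.SVMesh.starForm_svOperator_nonpos hA hU hβ)
    (fun v => ?_) (fun l hl => hsol.stage_eq hn hl)
  · rw [hnorm, hnorm, hsol.last_stage n hn, ← hsol.first_stage n hn, mul_right_comm C₂ C τ,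
      mul_assoc (C₂ * τ), Finset.mul_sum]
    refine key.trans (add_le_add_right (mul_le_mul_of_nonneg_left (Finset.sum_le_sum
      fun l hl => ?_) (by positivity)) _)
    exact RKSV.SVMesh.starForm_source_le hC (fun i v hv => (hb' i v hv).2.2.2)
      (hg n hn l (Finset.mem_range.1 hl)) _ (M.cvInt_ofCvIntegral _)
  · have hinv := RKSV.SVMesh.starForm_svOperator_le hC hρ
      (fun i v hv => ⟨(hb' i v hv).1, (hb' i v hv).2.2⟩) β v
    have hK : 0 ≤ 8 * (k + 1) * (C * ρ * β) ^ 2 * M.starForm A v v :=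
      mul_nonneg (by positivity) (hnonneg v)
    calc _ ≤ τ ^ 2 * (8 * (k + 1) * (C * ρ * β) ^ 2 / M.meshSize ^ 2 * M.starForm A v v) :=
          mul_le_mul_of_nonneg_left hinv (sq_nonneg _)
      _ = τ * (8 * (k + 1) * (C * ρ * β) ^ 2 * M.starForm A v v) * (τ / M.meshSize ^ 2) := by
          ring
      _ ≤ τ * (8 * (k + 1) * (C * ρ * β) ^ 2 * M.starForm A v v) * 1 :=
          mul_le_mul_of_nonneg_left ((div_le_one (by positivity)).2 hτh) (by positivity)
      _ = _ := by ring
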